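/- Throughout, a trace on a von Neumann algebra is a normal, faithful, finite trace $\tau$ with $\tau(1)=1$, and $\|x\|_2=\tau(x^*x)^{1/2}$. Let $B$ be a von Neumann algebra acting on a Hilbert space $K$, let $\tau$ be a trace on $B$ (so that $B$ is finite), and let $\alpha$ be an action of a (discrete) abelian group $\Gamma_0$ on $B$ by $*$-automorphisms with $\tau\circ\alpha_g=\tau$ for all $g\in\Gamma_0$. Let $M=B\rtimes_\alpha\Gamma_0$ be the crossed product, that is, the von Neumann algebra on $\ell^2(\Gamma_0,K)$ generated by the operators $(\pi(b)\xi)(g)=\alpha_{g^{-1}}(b)\xi(g)$, $b\in B$, and $(\lambda(h)\xi)(g)=\xi(h^{-1}g)$, $h\in\Gamma_0$. Equip $M$ with the trace, still denoted by $\tau$, that sends $x=\sum_\gamma \pi(x(\gamma))\lambda(\gamma)$ to $\tau(x(1))$. Let $A=L(\Gamma_0)\subset M$ be the abelian von Neumann subalgebra generated by $\lambda(\Gamma_0)$, and let $E_A$ be the $\tau$-preserving conditional expectation of $M$ onto $A$, characterised by $E_A(x)\in A$ and $\tau(E_A(x)a)=\tau(xa)$ for all $x\in M$, $a\in A$. An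 infinite set $S$ of unitaries of $M$ is called almost orthonormal if for every $x\in M$ and every $\varepsilon>0$ there is a finite set $F\subset S$ with $|\tau(ux)|\le\varepsilon$ for all $u\in S\setminus F$. The subalgebra $A$ is called strongly mixing in $M$ if for every almost orthonormal infinite subgroup $G$ of the unitary group of $A$ and all $x,y\in M$, $$\lim_{u\to\infty,\ u\in G}\|E_A(uxu^{-1}y)-E_A(x)E_A(y)\|_2=0,$$ where the limit is taken along the complements of the finite subsets of $G$. The action $\alpha$ is called strongly mixing if for every finite set $F\subset B$ and every $\varepsilon>0$ there is a finite set $E\subset\Gamma_0$ such that $|\tau(\alpha_g(a)b)-\tau(a)\tau(b)|<\varepsilon$ for all $a,b\in F$ and all $g\in\Gamma_0\setminus E$. Then $A=L(\Gamma_0)$ is strongly mixing in $M=B\rtimes_\alpha\Gamma_0$ if and only if the action $\alpha$ of $\Gamma_0$ on $B$ is strongly mixing. -/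

import Mathlib

namespace CrossedMixing

open Filter Topology
open scoped ENNReal ComplexOrder

noncomputable section

/-! ### Von Neumann algebras, traces, conditional expectations, strong mixing -/

section General

variable {H : Type*} [NormedAddCommGroup H] [InnerProductSpace ℂ H] [CompleteSpace H]

/-- The von Neumann algebra `(S ∪ S*)''` generated by a set `S` of bounded operators on `H`. -/
def generatedBy (S : Set (H →L[ℂ] H)) : VonNeumannAlgebra H where
  toStarSubalgebra := StarSubalgebra.centralizer ℂ (StarSubalgebra.centralizer ℂ S : Set (H →L[ℂ] H))
  centralizer_centralizer' := by
    change Set.centralizer (Set.centralizer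
      ((StarSubalgebra.centralizer ℂ (StarSubalgebra.centralizer ℂ S : Set (H →L[ℂ] H)) :
        StarSubalgebra ℂ (H →L[ℂ] H)) : Set (H →L[ℂ] H))) =
      ((StarSubalgebra.centralizer ℂ (StarSubalgebra.centralizer ℂ S : Set (H →L[ℂ] H)) :
        StarSubalgebra ℂ (H →L[ℂ] H)) : Set (H →L[ℂ] H))
    rw [StarSubalgebra.coe_centralizer_centralizer, Set.centralizer_centralizer_centralizer]

/-- A linear functional on a von Neumann algebra is normal if it is ultraweakly continuous, i.e.
of the form `x ↦ ∑ₙ ⟪ηₙ, x ξₙ⟫` with `∑ ‖ξₙ‖² < ∞` and `∑ ‖ηₙ‖² < ∞`. -/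
def IsNormalFunctional (M : VonNeumannAlgebra H) (φ : M.toStarSubalgebra →ₗ[ℂ] ℂ) : Prop :=
  ∃ ξ η : ℕ → H, Summable (fun n => ‖ξ n‖ ^ 2) ∧ Summable (fun n => ‖η n‖ ^ 2) ∧
    ∀ x : M.toStarSubalgebra,
      HasSum (fun n => inner ℂ (η n) ((x : H →L[ℂ] H) (ξ n))) (φ x)

/-- A trace on `M`: a normal, faithful, finite, normalised (`τ 1 = 1`) trace. -/
structure IsTrace (M : VonNeumannAlgebra H) (τ : M.toStarSubalgebra →ₗ[ℂ] ℂ) : Prop where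
  normal : IsNormalFunctional M τ
  nonneg : ∀ x, 0 ≤ τ (star x * x)
  faithful : ∀ x, τ (star x * x) = 0 → x = 0
  tracial : ∀ x y, τ (x * y) = τ (y * x)
  normalised : τ 1 = 1

/-- The norm `‖x‖₂ = τ(x* x)^{1/2}`. -/
def norm₂ {M : VonNeumannAlgebra H} (τ : M.toStarSubalgebra →ₗ[ℂ] ℂ)
    (x : M.toStarSubalgebra) : ℝ :=
  Real.sqrt (τ (star x * x)).re

/-- `E` is the `τ`-preserving conditional expectation of `M` onto its von Neumann subalgebra `A`,
characterised by `E x ∈ A` and `τ(E(x) a) = τ(x a)` for all `x ∈ M` and `a ∈ A`. -/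
def IsCondExp {M : VonNeumannAlgebra H} (τ : M.toStarSubalgebra →ₗ[ℂ] ℂ)
    (A : VonNeumannAlgebra H) (E : M.toStarSubalgebra → M.toStarSubalgebra) : Prop :=
  (∀ x, (E x : H →L[ℂ] H) ∈ A) ∧
    ∀ x a : M.toStarSubalgebra, (a : H →L[ℂ] H) ∈ A → τ (E x * a) = τ (x * a)

/-- An infinite set `S` of unitaries of `M` is almost orthonormal if for all `x ∈ M` and `ε > 0`,
`|τ(u x)| ≤ ε` for all `u ∈ S` outside a finite subset. -/
def AlmostOrthonormal {M : VonNeumannAlgebra H} (τ : M.toStarSubalgebra →ₗ[ℂ] ℂ)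
    (S : Set (unitary M.toStarSubalgebra)) : Prop :=
  S.Infinite ∧ ∀ x : M.toStarSubalgebra, ∀ ε : ℝ, 0 < ε →
    ∃ F : Set (unitary M.toStarSubalgebra), F.Finite ∧ F ⊆ S ∧
      ∀ u ∈ S \ F, ‖τ ((u : M.toStarSubalgebra) * x)‖ ≤ ε

/-- The action by conjugation of a group `G` of unitaries on `M` is strongly mixing relative to the
range of the conditional expectation `E`: for all `x, y ∈ M`,
`‖E(u x u⁻¹ y) - E(x) E(y)‖₂ → 0` as `u → ∞` in the discrete group `G`. -/
def StronglyMixingRel {M : VonNeumannAlgebra H} (τ : M.toStarSubalgebra →ₗ[ℂ] ℂ)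
    (E : M.toStarSubalgebra → M.toStarSubalgebra)
    (G : Subgroup (unitary M.toStarSubalgebra)) : Prop :=
  ∀ x y : M.toStarSubalgebra,
    Tendsto (fun u : G => norm₂ τ
      (E (((u : unitary M.toStarSubalgebra) : M.toStarSubalgebra) * x *
        (((u : unitary M.toStarSubalgebra)⁻¹ : unitary M.toStarSubalgebra) :
          M.toStarSubalgebra) * y) - E x * E y)) cofinite (𝓝 0)

/-- `A` is strongly mixing in `(M, τ)`: for every almost orthonormal infinite subgroup `G` of the
unitary group of `A`, the action of `G` on `M` by conjugation is strongly mixing relative to `A`.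
The conditional expectation onto `A` (unique, as `τ` is faithful) is asserted to exist. -/
def StronglyMixingIn {M : VonNeumannAlgebra H} (τ : M.toStarSubalgebra →ₗ[ℂ] ℂ)
    (A : VonNeumannAlgebra H) : Prop :=
  ∃ E : M.toStarSubalgebra → M.toStarSubalgebra, IsCondExp τ A E ∧
    ∀ G : Subgroup (unitary M.toStarSubalgebra),
      (∀ u ∈ G, ((u : M.toStarSubalgebra) : H →L[ℂ] H) ∈ A) →
      AlmostOrthonormal τ (G : Set (unitary M.toStarSubalgebra)) →
      StronglyMixingRel τ E G

/-- A von Neumann algebra is norm closed (so that it is a C*-algebra). -/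
theorem isClosed_coe (M : VonNeumannAlgebra H) :
    IsClosed (M.toStarSubalgebra : Set (H →L[ℂ] H)) := by
  rw [VonNeumannAlgebra.coe_toStarSubalgebra, ← M.centralizer_centralizer]
  exact Set.isClosed_centralizer _

end General

/-! ### The crossed product of `B ⊆ B(K)` by a group, acting on `ℓ²(Γ, K)` -/

section CrossedProduct

variable {K : Type*} [NormedAddCommGroup K] [InnerProductSpace ℂ K]
variable {Γ : Type*}

/-- The Hilbert space `ℓ²(Γ, K)`. -/
abbrev L2 (Γ K : Type*) [NormedAddCommGroup K] : Type _ := lp (fun _ : Γ => K) 2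

theorem memℓp_aux (r : Γ → Γ) (hr : Function.Injective r) (T : Γ → K →L[ℂ] K) (C : ℝ)
    (hT : ∀ g, ‖T g‖ ≤ C) (ξ : L2 Γ K) : Memℓp (fun g => T g (ξ (r g))) 2 := by
  have h2 : 0 < (2 : ℝ≥0∞).toReal := by norm_num
  have hs : Summable fun g => ‖ξ (r g)‖ ^ (2 : ℝ≥0∞).toReal :=
    ((lp.memℓp ξ).summable h2).comp_injective hr
  refine memℓp_gen ?_
  refine Summable.of_nonneg_of_le (fun g => by positivity) (fun g => ?_)
    (hs.mul_left (C ^ (2 : ℝ≥0∞).toReal))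
  have hC : 0 ≤ C := (norm_nonneg _).trans (hT g)
  rw [← Real.mul_rpow hC (norm_nonneg _)]
  refine Real.rpow_le_rpow (norm_nonneg _) ?_ h2.le
  exact (T g).le_of_opNorm_le (hT g) _

/-- The operator `(Φ ξ)(g) = T_g (ξ (r g))` on `ℓ²(Γ, K)`, for an injective map `r` and a
bounded family of operators `T_g`. -/
def lpOp (r : Γ → Γ) (hr : Function.Injective r) (T : Γ → K →L[ℂ] K) (C : ℝ)
    (hT : ∀ g, ‖T g‖ ≤ C) : L2 Γ K →L[ℂ] L2 Γ K :=
  LinearMap.mkContinuous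
    { toFun := fun ξ => ⟨fun g => T g (ξ (r g)), memℓp_aux r hr T C hT ξ⟩
      map_add' := fun ξ η => by
        ext g
        exact map_add (T g) _ _
      map_smul' := fun c ξ => by
        ext g
        exact map_smul (T g) c _ } (max C 0) (fun ξ => by
    have h2 : 0 < (2 : ℝ≥0∞).toReal := by norm_num
    have hC : (0 : ℝ) ≤ max C 0 := le_max_right _ _
    refine lp.norm_le_of_forall_sum_le h2 (by positivity) (fun s => ?_)
    classical
    calc ∑ g ∈ s, ‖T g (ξ (r g))‖ ^ (2 : ℝ≥0∞).toReal
        ≤ ∑ g ∈ s, (max C 0) ^ (2 : ℝ≥0∞).toReal * ‖ξ (r g)‖ ^ (2 : ℝ≥0∞).toReal := by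
          refine Finset.sum_le_sum fun g _ => ?_
          rw [← Real.mul_rpow hC (norm_nonneg _)]
          refine Real.rpow_le_rpow (norm_nonneg _) ?_ h2.le
          exact (T g).le_of_opNorm_le ((hT g).trans (le_max_left _ _)) _
      _ = (max C 0) ^ (2 : ℝ≥0∞).toReal *
            ∑ g ∈ s.image r, ‖ξ g‖ ^ (2 : ℝ≥0∞).toReal := by
          rw [← Finset.mul_sum, Finset.sum_image (fun a _ b _ h => hr h)]
      _ ≤ (max C 0) ^ (2 : ℝ≥0∞).toReal * ‖ξ‖ ^ (2 : ℝ≥0∞).toReal := by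
          gcongr
          exact lp.sum_rpow_le_norm_rpow h2 ξ _
      _ = (max C 0 * ‖ξ‖) ^ (2 : ℝ≥0∞).toReal := by
          rw [Real.mul_rpow hC (norm_nonneg _)])

@[simp]
theorem lpOp_apply (r : Γ → Γ) (hr : Function.Injective r) (T : Γ → K →L[ℂ] K) (C : ℝ)
    (hT : ∀ g, ‖T g‖ ≤ C) (ξ : L2 Γ K) (g : Γ) : lpOp r hr T C hT ξ g = T g (ξ (r g)) := rfl

variable [Group Γ]

/-- `(λ(h) ξ)(g) = ξ(h⁻¹ g)` on `ℓ²(Γ, K)`. -/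
def lam (K : Type*) [NormedAddCommGroup K] [InnerProductSpace ℂ K] (h : Γ) :
    L2 Γ K →L[ℂ] L2 Γ K :=
  lpOp (fun g => h⁻¹ * g) (mul_right_injective _) (fun _ => ContinuousLinearMap.id ℂ K) 1
    (fun _ => ContinuousLinearMap.norm_id_le)

variable [CompleteSpace K]

theorem norm_aut_le (B : VonNeumannAlgebra K) (β : B.toStarSubalgebra ≃⋆ₐ[ℂ] B.toStarSubalgebra)
    (b : B.toStarSubalgebra) : ‖((β b : B.toStarSubalgebra) : K →L[ℂ] K)‖ ≤ ‖(b : K →L[ℂ] K)‖ := by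
  have : IsClosed (B.toStarSubalgebra : Set (K →L[ℂ] K)) := isClosed_coe B
  exact (NonUnitalStarAlgHom.norm_apply_le β b :)

/-- `(π(b) ξ)(g) = α_{g⁻¹}(b) ξ(g)` on `ℓ²(Γ, K)`. -/
def piRep {B : VonNeumannAlgebra K}
    (α : Γ →* (B.toStarSubalgebra ≃⋆ₐ[ℂ] B.toStarSubalgebra)) (b : B.toStarSubalgebra) :
    L2 Γ K →L[ℂ] L2 Γ K :=
  lpOp id Function.injective_id (fun g => ((α g⁻¹ b : B.toStarSubalgebra) : K →L[ℂ] K))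
    ‖(b : K →L[ℂ] K)‖ (fun g => norm_aut_le B (α g⁻¹) b)

/-- The crossed product `B ⋊_α Γ`: the von Neumann algebra on `ℓ²(Γ, K)` generated by
`π(B)` and `λ(Γ)`. -/
def crossedProduct {B : VonNeumannAlgebra K}
    (α : Γ →* (B.toStarSubalgebra ≃⋆ₐ[ℂ] B.toStarSubalgebra)) : VonNeumannAlgebra (L2 Γ K) :=
  generatedBy (Set.range (piRep α) ∪ Set.range (lam (Γ := Γ) K))

/-- `L(Γ)`, as the von Neumann algebra on `ℓ²(Γ, K)` generated by the unitaries `λ(h)`. -/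
def groupVN (Γ : Type*) [Group Γ] (K : Type*) [NormedAddCommGroup K] [InnerProductSpace ℂ K]
    [CompleteSpace K] : VonNeumannAlgebra (L2 Γ K) :=
  generatedBy (Set.range (lam (Γ := Γ) K))

open scoped Classical in
/-- The compression of an operator on `ℓ²(Γ, K)` to the summand `δ₁ ⊗ K`. -/
def compress (x : L2 Γ K →L[ℂ] L2 Γ K) : K →L[ℂ] K :=
  (lp.evalCLM ℂ (fun _ : Γ => K) 2 1).comp
    (x.comp (lp.singleContinuousLinearMap ℂ (fun _ : Γ => K) 2 1))

/-- The compression of an element of the crossed product belongs to `B`. -/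
theorem compress_mem {B : VonNeumannAlgebra K}
    (α : Γ →* (B.toStarSubalgebra ≃⋆ₐ[ℂ] B.toStarSubalgebra))
    {x : L2 Γ K →L[ℂ] L2 Γ K} (hx : x ∈ (crossedProduct α).toStarSubalgebra) :
    compress x ∈ B.toStarSubalgebra := by
  classical
  rw [VonNeumannAlgebra.mem_carrier, ← B.centralizer_centralizer]
  intro c hc
  let d : L2 Γ K →L[ℂ] L2 Γ K := lpOp id Function.injective_id (fun _ => c) ‖c‖ (fun _ => le_rfl)
  have key : ∀ c' : K →L[ℂ] K, c' ∈ Set.centralizer (B : Set (K →L[ℂ] K)) →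
      ∀ s ∈ Set.range (piRep α) ∪ Set.range (lam (Γ := Γ) K),
        s * lpOp id Function.injective_id (fun _ => c') ‖c'‖ (fun _ => le_rfl) =
          lpOp id Function.injective_id (fun _ => c') ‖c'‖ (fun _ => le_rfl) * s := by
    rintro c' hc' s (⟨b, rfl⟩ | ⟨h, rfl⟩)
    · ext ξ g
      exact DFunLike.congr_fun (hc' _ (α g⁻¹ b).2) (ξ g)
    · refine ContinuousLinearMap.ext fun ξ => lp.ext (funext fun g => ?_)
      change lam K h _ g = _
      rw [lam, lpOp_apply]
      rfl
  have hstar : star d = lpOp id Function.injective_id (fun _ => star c) ‖star c‖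
      (fun _ => le_rfl) := by
    rw [ContinuousLinearMap.star_eq_adjoint, eq_comm, ContinuousLinearMap.eq_adjoint_iff]
    intro ξ η
    rw [lp.inner_eq_tsum, lp.inner_eq_tsum]
    refine tsum_congr fun g => ?_
    exact ContinuousLinearMap.adjoint_inner_left c (η g) (ξ g)
  have hc' : star c ∈ Set.centralizer (B : Set (K →L[ℂ] K)) := by
    intro b hb
    have := hc (star b) (star_mem hb)
    simpa using (congrArg star this).symm
  have hd : d ∈ (StarSubalgebra.centralizer ℂ
      (Set.range (piRep α) ∪ Set.range (lam (Γ := Γ) K)) : Set _) := by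
    refine (StarSubalgebra.mem_centralizer_iff ℂ).2 fun s hs => ⟨key c hc s hs, ?_⟩
    have h1 := key (star c) hc' s hs
    rw [← hstar] at h1
    simpa using (congrArg star h1).symm
  have hcomm : d * x = x * d := ((StarSubalgebra.mem_centralizer_iff ℂ).1 hx d hd).1
  ext k
  have h1 : d (lp.single 2 (1 : Γ) k) = lp.single 2 (1 : Γ) (c k) := by
    ext g
    by_cases hg : g = 1
    · subst hg
      simp [d]
    · simp [d, hg]
  have h2 := congrArg (fun ζ : L2 Γ K => ζ 1)
    (DFunLike.congr_fun hcomm (lp.single 2 (1 : Γ) k))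
  change c (x (lp.single 2 (1 : Γ) k) 1) = x (d (lp.single 2 (1 : Γ) k)) 1 at h2
  rw [h1] at h2
  exact h2

/-- The trace on the crossed product: `τ` of the coefficient at the neutral element, so that
`∑ π(x(γ)) λ(γ) ↦ τ(x(1))`. -/
def crossedTrace {B : VonNeumannAlgebra K}
    (α : Γ →* (B.toStarSubalgebra ≃⋆ₐ[ℂ] B.toStarSubalgebra))
    (τ : B.toStarSubalgebra →ₗ[ℂ] ℂ) : (crossedProduct α).toStarSubalgebra →ₗ[ℂ] ℂ where
  toFun x := τ ⟨compress (x : L2 Γ K →L[ℂ] L2 Γ K), compress_mem α x.2⟩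
  map_add' x y := by
    rw [← map_add]
    congr 1
  map_smul' c x := by
    rw [RingHom.id_apply, ← map_smul]
    congr 1

/-- A `τ`-preserving action `α` on `B` is strongly mixing if for every finite `F ⊆ B` and `ε > 0`
there is a finite `E ⊆ Γ` with `|τ(α_g(a) b) - τ(a) τ(b)| < ε` for all `a, b ∈ F`, `g ∉ E`. -/
def StronglyMixingAction {B : VonNeumannAlgebra K}
    (α : Γ →* (B.toStarSubalgebra ≃⋆ₐ[ℂ] B.toStarSubalgebra))
    (τ : B.toStarSubalgebra →ₗ[ℂ] ℂ) : Prop :=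
  ∀ F : Finset B.toStarSubalgebra, ∀ ε : ℝ, 0 < ε → ∃ E : Finset Γ,
    ∀ a ∈ F, ∀ b ∈ F, ∀ g : Γ, g ∉ E → ‖τ (α g a * b) - τ a * τ b‖ < ε

end CrossedProduct

end

end CrossedMixing

/-!
Let `E` be the conditional expectation onto `L(Γ)`; it exists because the coefficients `τ(x(g))`
of `x ∈ M` are the symbol of a bounded convolution operator, and `E(π(b) λ(g)) = τ(b) λ(g)`.

If `L(Γ)` is strongly mixing, take `G = λ(Γ)`, which is almost orthonormal since the coefficients of
`x` are square summable, and apply the trace to `E(λ(g) π(a) λ(g)⁻¹ π(b)) - E(π(a)) E(π(b))`.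

Conversely, let `u ∈ L(Γ)` be unitary and let `c_g` be the Fourier coefficients of `u*`. Then
`‖E(u π(a) u* π(b)) - E(π(a)) E(π(b))‖₂² = ∑ |c_g|² |τ(α_{g⁻¹}(a) b) - τ(a) τ(b)|²`.
The weights `|c_g|²` have sum `1`. Along an almost orthonormal group of unitaries they escape to
infinity in `Γ`, where mixing of the action makes the second factor small. General `x, y ∈ M` are
approximated in `‖·‖₂` by linear combinations of the monomials `λ(g) π(b)`; the factors `λ(g)` come
out of the defect because `Γ` is abelian.
-/

namespace CrossedMixing

open Filter Topology
open scoped ENNReal ComplexOrder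

noncomputable section

section PositiveFunctional

variable {H : Type*} [NormedAddCommGroup H] [InnerProductSpace ℂ H] [CompleteSpace H]
  {M : VonNeumannAlgebra H} {τ : M.toStarSubalgebra →ₗ[ℂ] ℂ}

theorem norm₂_nonneg (x : M.toStarSubalgebra) : 0 ≤ norm₂ τ x := Real.sqrt_nonneg _

theorem norm₂_smul (c : ℂ) (x : M.toStarSubalgebra) : norm₂ τ (c • x) = ‖c‖ * norm₂ τ x := by
  rw [norm₂, norm₂, star_smul, smul_mul_smul_comm, map_smul, RCLike.star_def, Complex.conj_mul',
    smul_eq_mul, ← Complex.ofReal_pow, Complex.re_ofReal_mul, Real.sqrt_mul (by positivity),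
    Real.sqrt_sq (norm_nonneg _)]

theorem norm₂_mul_of_star_mul_self {u : M.toStarSubalgebra} (hu : star u * u = 1)
    (x : M.toStarSubalgebra) : norm₂ τ (u * x) = norm₂ τ x := by
  rw [norm₂, norm₂, star_mul, mul_assoc, ← mul_assoc (star u), hu, one_mul]

theorem norm₂_sq (hpos : ∀ x, 0 ≤ τ (star x * x)) (x : M.toStarSubalgebra) :
    norm₂ τ x ^ 2 = (τ (star x * x)).re :=
  Real.sq_sqrt (Complex.nonneg_iff.1 (hpos x)).1

theorem map_star_of_nonneg (hpos : ∀ x, 0 ≤ τ (star x * x)) (x : M.toStarSubalgebra) :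
    τ (star x) = starRingEnd ℂ (τ x) := by
  have him (z : M.toStarSubalgebra) : (τ (star z * z)).im = 0 :=
    (Complex.nonneg_iff.1 (hpos z)).2.symm
  -- polarisation: expand the real numbers `τ(z* z)` for `z = 1 + x` and `z = 1 + i x`
  have polar (c : ℂ) : (c * τ x).im + (starRingEnd ℂ c * τ (star x)).im = 0 := by
    have expand : star (1 + c • x) * (1 + c • x) =
        star 1 * 1 + c • x + starRingEnd ℂ c • star x + star (c • x) * (c • x) := by
      simp only [star_add, star_one, star_smul, add_mul, mul_add, one_mul, mul_one,
        RCLike.star_def]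
      abel
    have h := him (1 + c • x)
    simpa only [expand, map_add, map_smul, smul_eq_mul, Complex.add_im, him, zero_add,
      add_zero] using h
  have hone := polar 1
  have hI := polar Complex.I
  simp only [map_one, one_mul, Complex.conj_I, neg_mul, Complex.neg_im, Complex.I_mul_im] at hone hI
  apply Complex.ext
  · rw [Complex.conj_re]
    linarith
  · rw [Complex.conj_im]
    linarith

/-- The positive semidefinite form `⟪x, y⟫ = τ(x* y)` of the GNS construction for `τ`. -/
abbrev gnsCore (hpos : ∀ x, 0 ≤ τ (star x * x)) :
    PreInnerProductSpace.Core ℂ M.toStarSubalgebra where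
  inner x y := τ (star x * y)
  conj_inner_symm x y := by rw [← map_star_of_nonneg hpos, star_mul, star_star]
  re_inner_nonneg x := (Complex.nonneg_iff.1 (hpos x)).1
  add_left x y z := by rw [star_add, add_mul, map_add]
  smul_left x y r := by
    rw [star_smul, smul_mul_assoc, map_smul]
    rfl

theorem norm_map_star_mul_le (hpos : ∀ x, 0 ≤ τ (star x * x)) (x y : M.toStarSubalgebra) :
    ‖τ (star x * y)‖ ≤ norm₂ τ x * norm₂ τ y :=
  letI := gnsCore hpos
  @InnerProductSpace.Core.norm_inner_le_norm ℂ M.toStarSubalgebra _ _ _ (gnsCore hpos) x y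

/-- `‖·‖₂` as a seminorm, for a positive functional `τ`. -/
def seminorm₂ (hpos : ∀ x, 0 ≤ τ (star x * x)) : Seminorm ℂ M.toStarSubalgebra :=
  Seminorm.of (norm₂ τ)
    (@norm_add_le M.toStarSubalgebra
      (@InnerProductSpace.Core.toSeminormedAddCommGroup ℂ M.toStarSubalgebra _ _ _
        (gnsCore hpos)).toSeminormedAddGroup)
    norm₂_smul

theorem norm₂_sub_le (hpos : ∀ x, 0 ≤ τ (star x * x)) (x y : M.toStarSubalgebra) :
    norm₂ τ (x - y) ≤ norm₂ τ x + norm₂ τ y :=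
  map_sub_le_add (seminorm₂ hpos) x y

theorem exists_star_mul_self_eq_norm_smul_sub {A : Type*} [CStarAlgebra A] (x y : A) :
    ∃ z, star z * z = ‖star x * x‖ • (star y * y) - star y * (star x * x) * y := by
  let _ : PartialOrder A := CStarAlgebra.spectralOrder A
  have _ : StarOrderedRing A := CStarAlgebra.spectralOrderedRing A
  have hle : star y * (star x * x) * y ≤ ‖star x * x‖ • (star y * y) :=
    CStarAlgebra.star_left_conjugate_le_norm_smul (hb := .star_mul_self x)
  obtain ⟨z, hz⟩ := CStarAlgebra.nonneg_iff_eq_star_mul_self.1 (sub_nonneg.2 hle)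
  exact ⟨z, hz.symm⟩

theorem norm₂_mul_le_norm_mul (hpos : ∀ x, 0 ≤ τ (star x * x)) (x y : M.toStarSubalgebra) :
    norm₂ τ (x * y) ≤ ‖x‖ * norm₂ τ y := by
  have hcl : IsClosed (M.toStarSubalgebra : Set (H →L[ℂ] H)) := isClosed_coe M
  let _ : CStarAlgebra M.toStarSubalgebra := StarSubalgebra.cstarAlgebra _ (h_closed := hcl)
  obtain ⟨z, hz⟩ := exists_star_mul_self_eq_norm_smul_sub x y
  have hsq : norm₂ τ (x * y) ^ 2 ≤ (‖x‖ * norm₂ τ y) ^ 2 := by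
    have h := (Complex.nonneg_iff.1 (hpos z)).1
    rw [hz, CStarRing.norm_star_mul_self, ← Complex.coe_smul, map_sub, map_smul, smul_eq_mul,
      Complex.sub_re, Complex.re_ofReal_mul, sub_nonneg] at h
    rw [mul_pow, norm₂_sq hpos, norm₂_sq hpos, sq ‖x‖, star_mul]
    simpa only [mul_assoc] using h
  exact le_of_sq_le_sq hsq (mul_nonneg (norm_nonneg _) (norm₂_nonneg _))

end PositiveFunctional

section Trace

variable {H : Type*} [NormedAddCommGroup H] [InnerProductSpace ℂ H] [CompleteSpace H]
  {M : VonNeumannAlgebra H} {τ : M.toStarSubalgebra →ₗ[ℂ] ℂ}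

namespace IsTrace

theorem norm₂_star (hτ : IsTrace M τ) (x : M.toStarSubalgebra) :
    norm₂ τ (star x) = norm₂ τ x := by
  rw [norm₂, norm₂, star_star, hτ.tracial]

theorem norm₂_mul_le_mul_norm (hτ : IsTrace M τ) (x y : M.toStarSubalgebra) :
    norm₂ τ (x * y) ≤ norm₂ τ x * ‖y‖ := by
  rw [← hτ.norm₂_star, star_mul, mul_comm, ← hτ.norm₂_star x, ← norm_star y]
  exact norm₂_mul_le_norm_mul hτ.nonneg _ _

theorem norm₂_mul_of_mul_star_self (hτ : IsTrace M τ) {u : M.toStarSubalgebra}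
    (hu : u * star u = 1) (x : M.toStarSubalgebra) : norm₂ τ (x * u) = norm₂ τ x := by
  rw [← hτ.norm₂_star, star_mul, norm₂_mul_of_star_mul_self (by rwa [star_star]), hτ.norm₂_star]

theorem norm₂_one (hτ : IsTrace M τ) : norm₂ τ 1 = 1 := by
  rw [norm₂, star_one, one_mul, hτ.normalised, Complex.one_re, Real.sqrt_one]

theorem norm_map_le (hτ : IsTrace M τ) (x : M.toStarSubalgebra) : ‖τ x‖ ≤ norm₂ τ x := by
  simpa only [star_one, one_mul, hτ.norm₂_one] using norm_map_star_mul_le hτ.nonneg 1 x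

end IsTrace

namespace IsCondExp

variable {A : VonNeumannAlgebra H} {E : M.toStarSubalgebra → M.toStarSubalgebra}

theorem eq_of_forall (hE : IsCondExp τ A E) (hτ : IsTrace M τ) {x d : M.toStarSubalgebra}
    (hd : (d : H →L[ℂ] H) ∈ A)
    (h : ∀ a : M.toStarSubalgebra, (a : H →L[ℂ] H) ∈ A → τ (d * a) = τ (x * a)) : E x = d := by
  have hmem : ((star (E x - d) : M.toStarSubalgebra) : H →L[ℂ] H) ∈ A :=
    star_mem (sub_mem (hE.1 x) hd)
  refine sub_eq_zero.1 (hτ.faithful _ ?_)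
  rw [hτ.tracial, sub_mul, map_sub, hE.2 _ _ hmem, h _ hmem, sub_self]

theorem map_apply (hE : IsCondExp τ A E) (x : M.toStarSubalgebra) : τ (E x) = τ x := by
  simpa only [mul_one] using hE.2 x 1 (one_mem A)

/-- The conditional expectation as a linear map. -/
def toLinearMap (hE : IsCondExp τ A E) (hτ : IsTrace M τ) :
    M.toStarSubalgebra →ₗ[ℂ] M.toStarSubalgebra where
  toFun := E
  map_add' x y := hE.eq_of_forall hτ (add_mem (hE.1 x) (hE.1 y)) fun a ha => by
    rw [add_mul, add_mul, map_add, map_add, hE.2 _ _ ha, hE.2 _ _ ha]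
  map_smul' c x := hE.eq_of_forall hτ (A.toStarSubalgebra.smul_mem (hE.1 x) c) fun a ha => by
    rw [RingHom.id_apply, smul_mul_assoc, smul_mul_assoc, map_smul, map_smul, hE.2 _ _ ha]

theorem map_mul_left (hE : IsCondExp τ A E) (hτ : IsTrace M τ) {a : M.toStarSubalgebra}
    (ha : (a : H →L[ℂ] H) ∈ A) (x : M.toStarSubalgebra) : E (a * x) = a * E x :=
  hE.eq_of_forall hτ (mul_mem ha (hE.1 x)) fun b hb => by
    rw [mul_assoc, hτ.tracial, mul_assoc, hE.2 _ _ (mul_mem hb ha), ← mul_assoc, hτ.tracial,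
      ← mul_assoc]

theorem map_mul_right (hE : IsCondExp τ A E) (hτ : IsTrace M τ) {a : M.toStarSubalgebra}
    (ha : (a : H →L[ℂ] H) ∈ A) (x : M.toStarSubalgebra) : E (x * a) = E x * a :=
  hE.eq_of_forall hτ (mul_mem (hE.1 x) ha) fun b hb => by
    rw [mul_assoc, hE.2 _ _ (mul_mem ha hb), mul_assoc]

theorem norm₂_le (hE : IsCondExp τ A E) (hτ : IsTrace M τ) (x : M.toStarSubalgebra) :
    norm₂ τ (E x) ≤ norm₂ τ x := by
  have hproj : τ (star (E x) * E x) = τ (star (E x) * x) := by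
    rw [hτ.tracial, hE.2 _ _ (star_mem (hE.1 x)), hτ.tracial]
  have hsq : norm₂ τ (E x) ^ 2 ≤ norm₂ τ (E x) * norm₂ τ x := by
    rw [norm₂_sq hτ.nonneg, hproj]
    exact (Complex.re_le_norm _).trans (norm_map_star_mul_le hτ.nonneg _ _)
  rcases (norm₂_nonneg (τ := τ) (E x)).eq_or_lt with h0 | h0
  · exact h0 ▸ norm₂_nonneg x
  · exact le_of_mul_le_mul_left (by rwa [← sq]) h0

end IsCondExp

theorem AlmostOrthonormal.tendsto {G : Subgroup (unitary M.toStarSubalgebra)}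
    (h : AlmostOrthonormal τ (G : Set (unitary M.toStarSubalgebra))) (x : M.toStarSubalgebra) :
    Tendsto (fun u : G => τ (((u : unitary M.toStarSubalgebra) : M.toStarSubalgebra) * x))
      cofinite (𝓝 0) := by
  rw [Metric.tendsto_nhds]
  intro ε hε
  obtain ⟨F, hF, -, hle⟩ := h.2 x (ε / 2) (half_pos hε)
  have hpre : {u : G | (u : unitary M.toStarSubalgebra) ∈ F}.Finite :=
    hF.preimage Subtype.val_injective.injOn
  filter_upwards [hpre.compl_mem_cofinite] with u hu
  rw [dist_zero_right]
  exact (hle u ⟨u.2, hu⟩).trans_lt (half_lt_self hε)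

end Trace

section Amplification

variable {ι ι' H : Type*} [NormedAddCommGroup H]

/-- A square summable family as an element of `ℓ²`. -/
def toL2 (ξ : ι → H) (h : Summable fun i => ‖ξ i‖ ^ 2) : L2 ι H :=
  ⟨ξ, memℓp_gen (by simpa using h)⟩

theorem hasSum_norm_sq (ξ : L2 ι H) : HasSum (fun i => ‖ξ i‖ ^ 2) (‖ξ‖ ^ 2) := by
  simpa using lp.hasSum_norm (p := 2) (by norm_num) ξ

/-- The vector `ξ ⊕ ξ'` of `ℓ²(ι, H) ⊕ ℓ²(ι', H) = ℓ²(ι ⊕ ι', H)`. -/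
def sumL2 (ξ : L2 ι H) (ξ' : L2 ι' H) : L2 (ι ⊕ ι') H :=
  toL2 (Sum.elim ξ ξ') (HasSum.sum (f := fun i => ‖Sum.elim ξ ξ' i‖ ^ 2)
    (hasSum_norm_sq ξ) (hasSum_norm_sq ξ')).summable

theorem norm_sumL2_sq (ξ : L2 ι H) (ξ' : L2 ι' H) : ‖sumL2 ξ ξ'‖ ^ 2 = ‖ξ‖ ^ 2 + ‖ξ'‖ ^ 2 :=
  (hasSum_norm_sq (sumL2 ξ ξ')).unique
    (HasSum.sum (f := fun i => ‖sumL2 ξ ξ' i‖ ^ 2) (hasSum_norm_sq ξ) (hasSum_norm_sq ξ'))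

variable [InnerProductSpace ℂ H]

theorem inner_sumL2 (ξ η : L2 ι H) (ξ' η' : L2 ι' H) :
    inner ℂ (sumL2 ξ ξ') (sumL2 η η') = inner ℂ ξ η + inner ℂ ξ' η' :=
  (lp.hasSum_inner (𝕜 := ℂ) (sumL2 ξ ξ') (sumL2 η η')).unique
    (HasSum.sum (f := fun i => inner ℂ (sumL2 ξ ξ' i) (sumL2 η η' i))
      (lp.hasSum_inner (𝕜 := ℂ) ξ η) (lp.hasSum_inner (𝕜 := ℂ) ξ' η'))

/-- The entry at `(m, n)` of the block matrix of an operator on `ℓ²(ι, H)`. -/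
def matrixCoeff [DecidableEq ι] (P : L2 ι H →L[ℂ] L2 ι H) (m n : ι) : H →L[ℂ] H :=
  lp.evalCLM ℂ (fun _ : ι => H) 2 m ∘L P ∘L lp.singleContinuousLinearMap ℂ (fun _ : ι => H) 2 n

variable [CompleteSpace H]

variable (ι H) in
/-- The amplification `x ↦ 1 ⊗ x` of operators on `H` to `ℓ²(ι, H)`. -/
def amp : (H →L[ℂ] H) →⋆ₐ[ℂ] (L2 ι H →L[ℂ] L2 ι H) where
  toFun x := lpOp id Function.injective_id (fun _ => x) ‖x‖ fun _ => le_rfl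
  map_one' := rfl
  map_mul' _ _ := rfl
  map_zero' := rfl
  map_add' _ _ := rfl
  commutes' _ := rfl
  map_star' x := by
    refine (ContinuousLinearMap.eq_adjoint_iff _ _).2 fun ξ η => ?_
    rw [lp.inner_eq_tsum, lp.inner_eq_tsum]
    exact tsum_congr fun i => ContinuousLinearMap.adjoint_inner_left x (η i) (ξ i)

theorem inner_amp_left (x : H →L[ℂ] H) (ξ η : L2 ι H) :
    inner ℂ (amp ι H x η) ξ = inner ℂ η (amp ι H (star x) ξ) := by
  rw [map_star, ContinuousLinearMap.star_eq_adjoint, ContinuousLinearMap.adjoint_inner_right]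

theorem amp_sumL2 (x : H →L[ℂ] H) (ξ : L2 ι H) (ξ' : L2 ι' H) :
    amp (ι ⊕ ι') H x (sumL2 ξ ξ') = sumL2 (amp ι H x ξ) (amp ι' H x ξ') := by
  ext i
  cases i <;> rfl

theorem amp_single [DecidableEq ι] (x : H →L[ℂ] H) (i : ι) (v : H) :
    amp ι H x (lp.single 2 i v) = lp.single 2 i (x v) := by
  ext j
  exact Pi.apply_single (fun _ => x) (fun _ => map_zero x) i v j

theorem commute_amp_iff [DecidableEq ι] {P : L2 ι H →L[ℂ] L2 ι H} {x : H →L[ℂ] H} :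
    Commute P (amp ι H x) ↔ ∀ m n, Commute (matrixCoeff P m n) x := by
  have hentry (m n : ι) (v : H) : (P * amp ι H x) (lp.single 2 n v) m = matrixCoeff P m n (x v) :=
    congrArg (fun ζ => P ζ m) (amp_single x n v)
  constructor
  · intro h m n
    ext v
    exact (hentry m n v).symm.trans (congrArg (fun T => T (lp.single 2 n v) m) h.eq)
  · intro h
    refine lp.ext_continuousLinearMap ENNReal.ofNat_ne_top fun n => ?_
    ext v m
    exact (hentry m n v).trans (DFunLike.congr_fun (h m n).eq v)

theorem commute_starProjection_iff {L : Submodule ℂ H} [L.HasOrthogonalProjection]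
    {T : H →L[ℂ] H} :
    Commute L.starProjection T ↔ (∀ v ∈ L, T v ∈ L) ∧ ∀ v ∈ L, star T v ∈ L := by
  rw [ContinuousLinearMap.IsIdempotentElem.commute_iff L.isIdempotentElem_starProjection,
    L.range_starProjection, L.ker_starProjection,
    ← ContinuousLinearMap.mem_invtSubmodule_adjoint_iff]
  rfl

end Amplification

section Generated

variable {H ι : Type*} [NormedAddCommGroup H] [InnerProductSpace ℂ H] [CompleteSpace H]
  {S T : Set (H →L[ℂ] H)} {x : H →L[ℂ] H}

theorem mem_generatedBy_iff :
    x ∈ generatedBy S ↔ ∀ c, (∀ s ∈ S, Commute s c ∧ Commute (star s) c) → Commute c x := by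
  change x ∈ StarSubalgebra.centralizer ℂ (StarSubalgebra.centralizer ℂ S : Set (H →L[ℂ] H)) ↔ _
  simp only [StarSubalgebra.mem_centralizer_iff, SetLike.mem_coe]
  exact ⟨fun h c hc => (h c hc).1,
    fun h c hc => ⟨h c hc, h _ ((StarSubalgebra.mem_centralizer_iff ℂ).1
      (star_mem ((StarSubalgebra.mem_centralizer_iff ℂ).2 hc)))⟩⟩

theorem subset_generatedBy (hx : x ∈ S) : x ∈ generatedBy S :=
  mem_generatedBy_iff.2 fun _ hc => (hc x hx).1.symm

theorem generatedBy_mono (h : S ⊆ T) (hx : x ∈ generatedBy S) : x ∈ generatedBy T :=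
  mem_generatedBy_iff.2 fun c hc => mem_generatedBy_iff.1 hx c fun s hs => hc s (h hs)

theorem commute_amp_of_mem_generatedBy {P : L2 ι H →L[ℂ] L2 ι H}
    (hP : ∀ s ∈ S, Commute P (amp ι H s) ∧ Commute P (amp ι H (star s))) (hx : x ∈ generatedBy S) :
    Commute P (amp ι H x) := by
  classical
  exact commute_amp_iff.2 fun m n => mem_generatedBy_iff.1 hx _ fun s hs =>
    ⟨(commute_amp_iff.1 (hP s hs).1 m n).symm, (commute_amp_iff.1 (hP s hs).2 m n).symm⟩

theorem amp_mem_of_mem_generatedBy {L : Submodule ℂ (L2 ι H)} [L.HasOrthogonalProjection]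
    (hL : ∀ s ∈ S, (∀ ζ ∈ L, amp ι H s ζ ∈ L) ∧ ∀ ζ ∈ L, amp ι H (star s) ζ ∈ L)
    (hx : x ∈ generatedBy S) {ζ : L2 ι H} (hζ : ζ ∈ L) : amp ι H x ζ ∈ L := by
  refine (commute_starProjection_iff.1 (commute_amp_of_mem_generatedBy (fun s hs => ?_) hx)).1 ζ hζ
  rw [commute_starProjection_iff, commute_starProjection_iff, ← map_star, ← map_star, star_star]
  exact ⟨hL s hs, (hL s hs).symm⟩

end Generated

section NormalFunctional

variable {H ι : Type*} [NormedAddCommGroup H] [InnerProductSpace ℂ H] [CompleteSpace H]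
  {M : VonNeumannAlgebra H} {φ ψ : M.toStarSubalgebra →ₗ[ℂ] ℂ}
  {X : Submonoid M.toStarSubalgebra} {x y : M.toStarSubalgebra}

/-- The linear map `x ↦ (1 ⊗ x) ξ` on `M`. -/
def evalAmp (M : VonNeumannAlgebra H) (ξ : L2 ι H) : M.toStarSubalgebra →ₗ[ℂ] L2 ι H where
  toFun x := amp ι H (x : H →L[ℂ] H) ξ
  map_add' _ _ := rfl
  map_smul' _ _ := rfl

theorem inner_evalAmp_star_mul_self (ξ η : L2 ι H) (x : M.toStarSubalgebra) :
    inner ℂ η (evalAmp M ξ (star x * x)) = inner ℂ (evalAmp M η x) (evalAmp M ξ x) :=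
  (inner_amp_left (x : H →L[ℂ] H) (evalAmp M ξ x) η).symm

/-- The closed linear span of the vectors `(1 ⊗ v) ξ`, `v ∈ X`, in `ℓ²(ι, H)`. -/
abbrev cyclicSubspace (X : Submonoid M.toStarSubalgebra) (ξ : L2 ι H) : Submodule ℂ (L2 ι H) :=
  ((Submodule.span ℂ (X : Set M.toStarSubalgebra)).map (evalAmp M ξ)).topologicalClosure

theorem self_mem_cyclicSubspace (ξ : L2 ι H) : ξ ∈ cyclicSubspace X ξ :=
  Submodule.le_topologicalClosure _ ⟨1, Submodule.subset_span (one_mem X), rfl⟩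

theorem amp_mem_cyclicSubspace {v : M.toStarSubalgebra} (hv : v ∈ X) {ξ ζ : L2 ι H}
    (hζ : ζ ∈ cyclicSubspace X ξ) : amp ι H (v : H →L[ℂ] H) ζ ∈ cyclicSubspace X ξ := by
  have hspan : Submodule.span ℂ (X : Set M.toStarSubalgebra) ≤
      (Submodule.span ℂ (X : Set M.toStarSubalgebra)).comap (LinearMap.mulLeft ℂ v) :=
    Submodule.span_le.2 fun w hw => Submodule.subset_span (mul_mem hv hw)
  refine map_mem_closure (amp ι H (v : H →L[ℂ] H)).continuous hζ ?_
  rintro _ ⟨w, hw, rfl⟩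
  exact ⟨v * w, hspan hw, rfl⟩

theorem evalAmp_mem_cyclicSubspace (hX : ∀ v ∈ X, star v ∈ X)
    (hx : (x : H →L[ℂ] H) ∈ generatedBy (Subtype.val '' (X : Set M.toStarSubalgebra)))
    (ξ : L2 ι H) : evalAmp M ξ x ∈ cyclicSubspace X ξ := by
  refine amp_mem_of_mem_generatedBy ?_ hx (self_mem_cyclicSubspace ξ)
  rintro _ ⟨v, hv, rfl⟩
  exact ⟨fun _ => amp_mem_cyclicSubspace hv, fun _ => amp_mem_cyclicSubspace (hX v hv)⟩

theorem isNormalFunctional_iff :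
    IsNormalFunctional M φ ↔ ∃ ξ η : L2 ℕ H, ∀ x, φ x = inner ℂ η (evalAmp M ξ x) := by
  constructor
  · rintro ⟨ξ, η, hξ, hη, h⟩
    exact ⟨toL2 ξ hξ, toL2 η hη, fun x => (h x).unique (lp.hasSum_inner (𝕜 := ℂ) (toL2 η hη) _)⟩
  · rintro ⟨ξ, η, h⟩
    exact ⟨ξ, η, (hasSum_norm_sq ξ).summable, (hasSum_norm_sq η).summable, fun x =>
      h x ▸ lp.hasSum_inner (𝕜 := ℂ) η (evalAmp M ξ x)⟩

namespace IsNormalFunctional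

theorem const_smul (hφ : IsNormalFunctional M φ) (c : ℂ) : IsNormalFunctional M (c • φ) := by
  obtain ⟨ξ, η, h⟩ := isNormalFunctional_iff.1 hφ
  refine isNormalFunctional_iff.2 ⟨c • ξ, η, fun x => ?_⟩
  rw [LinearMap.smul_apply, h, smul_eq_mul, ← inner_smul_right]
  exact congrArg (inner ℂ η) (map_smul (amp ℕ H (x : H →L[ℂ] H)) c ξ).symm

theorem comp_mulLeft (hφ : IsNormalFunctional M φ) (a : M.toStarSubalgebra) :
    IsNormalFunctional M (φ ∘ₗ LinearMap.mulLeft ℂ a) := by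
  obtain ⟨ξ, η, h⟩ := isNormalFunctional_iff.1 hφ
  refine isNormalFunctional_iff.2 ⟨ξ, amp ℕ H (star (a : H →L[ℂ] H)) η, fun x => ?_⟩
  rw [inner_amp_left, star_star]
  exact h (a * x)

theorem comp_mulRight (hφ : IsNormalFunctional M φ) (a : M.toStarSubalgebra) :
    IsNormalFunctional M (φ ∘ₗ LinearMap.mulRight ℂ a) := by
  obtain ⟨ξ, η, h⟩ := isNormalFunctional_iff.1 hφ
  exact isNormalFunctional_iff.2 ⟨evalAmp M ξ a, η, fun x => h (x * a)⟩

theorem eq_of_eqOn (hφ : IsNormalFunctional M φ) (hψ : IsNormalFunctional M ψ)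
    (hX : ∀ v ∈ X, star v ∈ X) (h : ∀ v ∈ X, φ v = ψ v)
    (hx : (x : H →L[ℂ] H) ∈ generatedBy (Subtype.val '' (X : Set M.toStarSubalgebra))) :
    φ x = ψ x := by
  obtain ⟨ξ, η, hφ⟩ := isNormalFunctional_iff.1 hφ
  obtain ⟨ξ', η', hψ⟩ := isNormalFunctional_iff.1 hψ
  have hinner (z : M.toStarSubalgebra) :
      φ z - ψ z = innerSL ℂ (sumL2 η (-η')) (evalAmp M (sumL2 ξ ξ') z) := by
    rw [hφ, hψ, innerSL_apply_apply, sub_eq_add_neg, ← inner_neg_left, ← inner_sumL2]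
    exact congrArg (inner ℂ _) (amp_sumL2 _ ξ ξ').symm
  have hker : cyclicSubspace X (sumL2 ξ ξ') ≤ (innerSL ℂ (sumL2 η (-η'))).ker := by
    refine Submodule.topologicalClosure_minimal _ ?_ (ContinuousLinearMap.isClosed_ker _)
    rw [Submodule.map_span_le]
    exact fun v hv => (hinner v).symm.trans (sub_eq_zero.2 (h v hv))
  rw [← sub_eq_zero, hinner]
  exact hker (evalAmp_mem_cyclicSubspace hX hx _)

theorem map_mul_comm (hφ : IsNormalFunctional M φ) (hX : ∀ v ∈ X, star v ∈ X)
    (h : ∀ v ∈ X, ∀ w ∈ X, φ (v * w) = φ (w * v))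
    (hx : (x : H →L[ℂ] H) ∈ generatedBy (Subtype.val '' (X : Set M.toStarSubalgebra)))
    (hy : (y : H →L[ℂ] H) ∈ generatedBy (Subtype.val '' (X : Set M.toStarSubalgebra))) :
    φ (x * y) = φ (y * x) :=
  (hφ.comp_mulLeft x).eq_of_eqOn (hφ.comp_mulRight x) hX (fun w hw =>
    (hφ.comp_mulRight w).eq_of_eqOn (hφ.comp_mulLeft w) hX (fun v hv => h v hv w hw) hx) hy

theorem exists_norm₂_le (hφ : IsNormalFunctional M φ) :
    ∃ ζ : L2 (ℕ ⊕ ℕ) H, ∀ x, norm₂ φ x ≤ ‖evalAmp M ζ x‖ := by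
  obtain ⟨ξ, η, hφ⟩ := isNormalFunctional_iff.1 hφ
  refine ⟨sumL2 ξ η, fun x => Real.sqrt_le_iff.2 ⟨norm_nonneg _, ?_⟩⟩
  have hinner : φ (star x * x) = inner ℂ (evalAmp M η x) (evalAmp M ξ x) := by
    rw [hφ, inner_evalAmp_star_mul_self]
  have hsum : ‖evalAmp M (sumL2 ξ η) x‖ ^ 2 = ‖evalAmp M ξ x‖ ^ 2 + ‖evalAmp M η x‖ ^ 2 :=
    (congrArg (‖·‖ ^ 2) (amp_sumL2 (x : H →L[ℂ] H) ξ η)).trans (norm_sumL2_sq _ _)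
  rw [hinner, hsum]
  have hcs : (inner ℂ (evalAmp M η x) (evalAmp M ξ x)).re ≤ ‖evalAmp M η x‖ * ‖evalAmp M ξ x‖ :=
    (Complex.re_le_norm _).trans (norm_inner_le_norm _ _)
  nlinarith [sq_nonneg (‖evalAmp M η x‖ - ‖evalAmp M ξ x‖), sq_nonneg ‖evalAmp M η x‖,
    sq_nonneg ‖evalAmp M ξ x‖]

theorem exists_norm₂_sub_lt (hφ : IsNormalFunctional M φ) (hX : ∀ v ∈ X, star v ∈ X)
    (hx : (x : H →L[ℂ] H) ∈ generatedBy (Subtype.val '' (X : Set M.toStarSubalgebra)))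
    {ε : ℝ} (hε : 0 < ε) :
    ∃ v ∈ Submodule.span ℂ (X : Set M.toStarSubalgebra), norm₂ φ (x - v) < ε := by
  obtain ⟨ζ, hζ⟩ := hφ.exists_norm₂_le
  obtain ⟨_, ⟨v, hv, rfl⟩, hlt⟩ :=
    Metric.mem_closure_iff.1 (evalAmp_mem_cyclicSubspace hX hx ζ) ε hε
  rw [dist_eq_norm, ← map_sub] at hlt
  exact ⟨v, hv, (hζ _).trans_lt hlt⟩

end IsNormalFunctional

end NormalFunctional

section Fubini

variable {ι κ K : Type*} [NormedAddCommGroup K]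

/-- The canonical map `ℓ²(ι, ℓ²(κ, K)) → ℓ²(ι × κ, K)`. -/
def uncurryL2 (ζ : L2 ι (L2 κ K)) : L2 (ι × κ) K :=
  toL2 (fun p => ζ p.1 p.2) <| (summable_prod_of_nonneg fun _ => sq_nonneg _).2
    ⟨fun i => (hasSum_norm_sq (ζ i)).summable,
      (hasSum_norm_sq ζ).summable.congr fun i => (hasSum_norm_sq (ζ i)).tsum_eq.symm⟩

theorem hasSum_tsum_inner [InnerProductSpace ℂ K] (ζ ζ' : L2 ι (L2 κ K)) :
    HasSum (fun k => ∑' i, inner ℂ (ζ i k) (ζ' i k)) (inner ℂ ζ ζ') := by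
  have hprod : HasSum (fun p : ι × κ => inner ℂ (ζ p.1 p.2) (ζ' p.1 p.2))
      (inner ℂ (uncurryL2 ζ) (uncurryL2 ζ')) := lp.hasSum_inner _ _
  have hinner : inner ℂ (uncurryL2 ζ) (uncurryL2 ζ') = (inner ℂ ζ ζ' : ℂ) :=
    (hprod.prod_fiberwise fun i => lp.hasSum_inner (𝕜 := ℂ) (ζ i) (ζ' i)).unique
      (lp.hasSum_inner ζ ζ')
  rw [← hinner]
  exact ((Equiv.prodComm κ ι).hasSum_iff.2 hprod).prod_fiberwise fun k =>
    (hprod.summable.prod_symm.prod_factor k).hasSum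

end Fubini

section CrossedProduct

variable {Γ K : Type*} [Group Γ] [NormedAddCommGroup K] [InnerProductSpace ℂ K]

theorem lam_single [DecidableEq Γ] (g h : Γ) (v : K) :
    lam K g (lp.single 2 h v) = lp.single 2 (g * h) v := by
  ext k
  change (lp.single 2 h v : L2 Γ K) (g⁻¹ * k) = _
  rw [lp.single_apply, lp.single_apply, Pi.single_apply, Pi.single_apply]
  exact if_congr inv_mul_eq_iff_eq_mul rfl rfl

variable [CompleteSpace K]

theorem star_lam (g : Γ) : star (lam K g) = lam K g⁻¹ := by
  symm
  refine (ContinuousLinearMap.eq_adjoint_iff _ _).2 fun ξ η => ?_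
  rw [lp.inner_eq_tsum, lp.inner_eq_tsum, ← (Equiv.mulLeft g⁻¹).tsum_eq]
  refine tsum_congr fun k => congrArg (fun h => inner ℂ (ξ h) (η (g⁻¹ * k))) ?_
  exact inv_mul_cancel_left g⁻¹ k

variable {B : VonNeumannAlgebra K} (α : Γ →* (B.toStarSubalgebra ≃⋆ₐ[ℂ] B.toStarSubalgebra))

/-- The elements of `B ⋊_α Γ`. -/
abbrev CrossedProduct : Type _ := (crossedProduct α).toStarSubalgebra

theorem act_one (b : B.toStarSubalgebra) : α 1 b = b := by
  rw [map_one]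
  rfl

theorem act_mul (g h : Γ) (b : B.toStarSubalgebra) : α (g * h) b = α g (α h b) := by
  rw [map_mul]
  rfl

theorem act_inv_act (g : Γ) (b : B.toStarSubalgebra) : α g⁻¹ (α g b) = b := by
  rw [← act_mul, inv_mul_cancel, act_one]

theorem act_act_inv (g : Γ) (b : B.toStarSubalgebra) : α g (α g⁻¹ b) = b := by
  rw [← act_mul, mul_inv_cancel, act_one]

theorem star_piRep (b : B.toStarSubalgebra) : star (piRep α b) = piRep α (star b) := by
  symm
  refine (ContinuousLinearMap.eq_adjoint_iff _ _).2 fun ξ η => ?_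
  rw [lp.inner_eq_tsum, lp.inner_eq_tsum]
  refine tsum_congr fun g => ?_
  change inner ℂ (((α g⁻¹ (star b) : B.toStarSubalgebra) : K →L[ℂ] K) (ξ g)) (η g) = _
  rw [map_star]
  exact ContinuousLinearMap.adjoint_inner_left _ (η g) (ξ g)

theorem piRep_congr {x : L2 Γ K →L[ℂ] L2 Γ K} {b : B.toStarSubalgebra}
    (h : ∀ ξ g, ((α g⁻¹ b : B.toStarSubalgebra) : K →L[ℂ] K) (ξ g) = x ξ g) : piRep α b = x :=
  ContinuousLinearMap.ext fun ξ => lp.ext (funext (h ξ))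

/-- The representation `π` of `B` in the crossed product. -/
def piHom : B.toStarSubalgebra →⋆ₐ[ℂ] CrossedProduct α where
  toFun b := ⟨piRep α b, subset_generatedBy (.inl ⟨b, rfl⟩)⟩
  map_one' := Subtype.ext <| piRep_congr α fun ξ g => by
    rw [map_one]
    rfl
  map_mul' a b := Subtype.ext <| piRep_congr α fun ξ g => by
    rw [map_mul]
    rfl
  map_zero' := Subtype.ext <| piRep_congr α fun ξ g => by
    rw [map_zero]
    rfl
  map_add' a b := Subtype.ext <| piRep_congr α fun ξ g => by
    rw [map_add]
    rfl
  commutes' c := Subtype.ext <| piRep_congr α fun ξ g => by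
    rw [Algebra.algebraMap_eq_smul_one, map_smul, map_one]
    rfl
  map_star' b := Subtype.ext (star_piRep α b).symm

/-- The representation `λ` of `Γ` in the crossed product. -/
def lamHom : Γ →* CrossedProduct α where
  toFun g := ⟨lam K g, subset_generatedBy (.inr ⟨g, rfl⟩)⟩
  map_one' := Subtype.ext <| ContinuousLinearMap.ext fun ξ => lp.ext <| funext fun k =>
    congrArg ξ (by simp only [inv_one, one_mul])
  map_mul' g h := Subtype.ext <| ContinuousLinearMap.ext fun ξ => lp.ext <| funext fun k =>
    congrArg ξ (by simp only [mul_inv_rev, mul_assoc])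

theorem star_lamHom (g : Γ) : star (lamHom α g) = lamHom α g⁻¹ := Subtype.ext (star_lam g)

theorem lamHom_mul_lamHom_inv (g : Γ) : lamHom α g * lamHom α g⁻¹ = 1 := by
  rw [← map_mul, mul_inv_cancel, map_one]

theorem lamHom_inv_mul_lamHom (g : Γ) : lamHom α g⁻¹ * lamHom α g = 1 := by
  rw [← map_mul, inv_mul_cancel, map_one]

/-- `λ` as a homomorphism into the unitary group. -/
def lamUnitary : Γ →* unitary (CrossedProduct α) :=
  (lamHom α).codRestrict _ fun g => by
    rw [Unitary.mem_iff, star_lamHom, lamHom_inv_mul_lamHom, lamHom_mul_lamHom_inv]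
    exact ⟨rfl, rfl⟩

theorem lamHom_mul_piHom (g : Γ) (b : B.toStarSubalgebra) :
    lamHom α g * piHom α b = piHom α (α g b) * lamHom α g := by
  refine Subtype.ext <| ContinuousLinearMap.ext fun ξ => lp.ext <| funext fun k => ?_
  change ((α (g⁻¹ * k)⁻¹ b : B.toStarSubalgebra) : K →L[ℂ] K) (ξ (g⁻¹ * k)) =
    ((α k⁻¹ (α g b) : B.toStarSubalgebra) : K →L[ℂ] K) (ξ (g⁻¹ * k))
  rw [← act_mul, mul_inv_rev, inv_inv]

theorem piHom_mul_lamHom (g : Γ) (b : B.toStarSubalgebra) :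
    piHom α b * lamHom α g = lamHom α g * piHom α (α g⁻¹ b) := by
  rw [lamHom_mul_piHom, act_act_inv]

theorem monomial_mul_monomial (g h : Γ) (a b : B.toStarSubalgebra) :
    lamHom α g * piHom α a * (lamHom α h * piHom α b) =
      lamHom α (g * h) * piHom α (α h⁻¹ a * b) := by
  rw [mul_assoc, ← mul_assoc (piHom α a), piHom_mul_lamHom, mul_assoc, ← map_mul, ← mul_assoc,
    ← map_mul]

/-- The operators `λ(g) π(b)`, whose span is the algebraic crossed product. -/
def monomials : Submonoid (CrossedProduct α) where
  carrier := Set.range fun p : Γ × B.toStarSubalgebra => lamHom α p.1 * piHom α p.2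
  one_mem' := ⟨1, by simp only [Prod.fst_one, Prod.snd_one, map_one, mul_one]⟩
  mul_mem' := by
    rintro _ _ ⟨⟨g, a⟩, rfl⟩ ⟨⟨h, b⟩, rfl⟩
    exact ⟨(g * h, α h⁻¹ a * b), (monomial_mul_monomial α g h a b).symm⟩

variable {α}

theorem star_mem_monomials {x : CrossedProduct α} (hx : x ∈ monomials α) :
    star x ∈ monomials α := by
  obtain ⟨⟨g, b⟩, rfl⟩ := hx
  exact ⟨(g⁻¹, α g (star b)), by
    rw [star_mul, star_lamHom, ← map_star, piHom_mul_lamHom, inv_inv]⟩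

theorem mem_generatedBy_monomials (x : CrossedProduct α) :
    (x : L2 Γ K →L[ℂ] L2 Γ K) ∈ generatedBy
      (Subtype.val '' (monomials α : Set (CrossedProduct α))) := by
  refine generatedBy_mono ?_ x.2
  rintro _ (⟨b, rfl⟩ | ⟨g, rfl⟩)
  · exact ⟨piHom α b, ⟨(1, b), by simp only [map_one, one_mul]⟩, rfl⟩
  · exact ⟨lamHom α g, ⟨(g, 1), by simp only [map_one, mul_one]⟩, rfl⟩

theorem lamHom_mem_groupVN (g : Γ) : (lamHom α g : L2 Γ K →L[ℂ] L2 Γ K) ∈ groupVN Γ K :=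
  subset_generatedBy ⟨g, rfl⟩

theorem star_mem_mrange_lamHom {x : CrossedProduct α} (hx : x ∈ MonoidHom.mrange (lamHom α)) :
    star x ∈ MonoidHom.mrange (lamHom α) := by
  obtain ⟨g, rfl⟩ := hx
  exact ⟨g⁻¹, (star_lamHom α g).symm⟩

theorem mem_generatedBy_mrange_lamHom {x : CrossedProduct α}
    (hx : (x : L2 Γ K →L[ℂ] L2 Γ K) ∈ groupVN Γ K) :
    (x : L2 Γ K →L[ℂ] L2 Γ K) ∈
      generatedBy (Subtype.val '' (MonoidHom.mrange (lamHom α) : Set (CrossedProduct α))) := by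
  refine generatedBy_mono ?_ hx
  rintro _ ⟨g, rfl⟩
  exact ⟨lamHom α g, ⟨g, rfl⟩, rfl⟩

/-- The coefficient `x(g) ∈ B` in the formal expansion `x = ∑ λ(g) π(x(g))`. The unitaries are
on the left, so that in the notation `x = ∑ π(x'(g)) λ(g)` one has `x'(g) = α_g(x(g))`. -/
def coef (x : CrossedProduct α) (g : Γ) : B.toStarSubalgebra :=
  ⟨compress ((lamHom α g⁻¹ * x : CrossedProduct α) : L2 Γ K →L[ℂ] L2 Γ K),
    compress_mem α (lamHom α g⁻¹ * x).2⟩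

open scoped Classical in
theorem coef_apply (x : CrossedProduct α) (g : Γ) (v : K) :
    (coef x g : K →L[ℂ] K) v = (x : L2 Γ K →L[ℂ] L2 Γ K) (lp.single 2 1 v) g :=
  congrArg ((x : L2 Γ K →L[ℂ] L2 Γ K) (lp.single 2 1 v)) (by simp only [inv_inv, mul_one])

theorem eq_zero_of_coef_mul_lamHom_eq_zero {x : CrossedProduct α}
    (h : ∀ k g, coef (x * lamHom α k) g = 0) : x = 0 := by
  classical
  refine Subtype.ext (lp.ext_continuousLinearMap ENNReal.ofNat_ne_top fun k => ?_)
  refine ContinuousLinearMap.ext fun v => lp.ext <| funext fun g => ?_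
  have hkg := coef_apply (x * lamHom α k) g v
  rw [h] at hkg
  change 0 = (x : L2 Γ K →L[ℂ] L2 Γ K) (lam K k (lp.single 2 1 v)) g at hkg
  rw [lam_single, mul_one] at hkg
  exact hkg.symm

end CrossedProduct

section CrossedTrace

variable {Γ K : Type*} [Group Γ] [NormedAddCommGroup K] [InnerProductSpace ℂ K] [CompleteSpace K]
  {B : VonNeumannAlgebra K} {α : Γ →* (B.toStarSubalgebra ≃⋆ₐ[ℂ] B.toStarSubalgebra)}
  {τ : B.toStarSubalgebra →ₗ[ℂ] ℂ}

theorem crossedTrace_lamHom_mul (g : Γ) (x : CrossedProduct α) :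
    crossedTrace α τ (lamHom α g * x) = τ (coef x g⁻¹) := by
  conv_lhs => rw [← inv_inv g]
  rfl

open scoped Classical in
theorem coef_piHom (b : B.toStarSubalgebra) (g : Γ) :
    coef (piHom α b) g = if g = 1 then b else 0 := by
  refine Subtype.ext (ContinuousLinearMap.ext fun v => ?_)
  rw [coef_apply]
  split_ifs with hg
  · change ((α g⁻¹ b : B.toStarSubalgebra) : K →L[ℂ] K) ((lp.single 2 1 v : L2 Γ K) g) = _
    rw [hg, lp.single_apply_self, inv_one, act_one]
  · change ((α g⁻¹ b : B.toStarSubalgebra) : K →L[ℂ] K) ((lp.single 2 1 v : L2 Γ K) g) = _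
    rw [lp.single_apply_ne _ _ _ hg, map_zero]
    rfl

open scoped Classical in
theorem crossedTrace_lamHom_mul_piHom (g : Γ) (b : B.toStarSubalgebra) :
    crossedTrace α τ (lamHom α g * piHom α b) = if g = 1 then τ b else 0 := by
  rw [crossedTrace_lamHom_mul, coef_piHom, apply_ite τ, map_zero]
  exact if_congr inv_eq_one rfl rfl

theorem crossedTrace_piHom (b : B.toStarSubalgebra) : crossedTrace α τ (piHom α b) = τ b := by
  classical
  simpa only [map_one, one_mul, if_true] using crossedTrace_lamHom_mul_piHom (α := α) 1 b

open scoped Classical in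
/-- The vector `(δ₁ ⊗ ξₙ)ₙ` of `ℓ²(ℕ, ℓ²(Γ, K))`. -/
def deltaOne (Γ : Type*) [Group Γ] (ξ : L2 ℕ K) : L2 ℕ (L2 Γ K) :=
  toL2 (fun n => lp.single 2 1 (ξ n)) <| (hasSum_norm_sq ξ).summable.congr fun n => by
    rw [lp.norm_single (p := 2) (by norm_num)]

theorem crossedTrace_eq_inner {ξ η : L2 ℕ K} (h : ∀ b, τ b = inner ℂ η (evalAmp B ξ b))
    (x : CrossedProduct α) : crossedTrace α τ x =
      inner ℂ (deltaOne Γ η) (evalAmp (crossedProduct α) (deltaOne Γ ξ) x) := by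
  classical
  refine (h _).trans ?_
  rw [lp.inner_eq_tsum, lp.inner_eq_tsum]
  exact tsum_congr fun n => (lp.inner_single_left (𝕜 := ℂ) 1 (η n)
    ((x : L2 Γ K →L[ℂ] L2 Γ K) (lp.single 2 1 (ξ n)))).symm

theorem crossedTrace_normal (hτ : IsNormalFunctional B τ) :
    IsNormalFunctional (crossedProduct α) (crossedTrace α τ) := by
  obtain ⟨ξ, η, h⟩ := isNormalFunctional_iff.1 hτ
  exact isNormalFunctional_iff.2 ⟨deltaOne Γ ξ, deltaOne Γ η, crossedTrace_eq_inner h⟩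

theorem hasSum_coef (hτ : IsNormalFunctional B τ) (x : CrossedProduct α) :
    HasSum (fun g => τ (star (coef x g) * coef x g)) (crossedTrace α τ (star x * x)) := by
  obtain ⟨ξ, η, h⟩ := isNormalFunctional_iff.1 hτ
  have hinner : crossedTrace α τ (star x * x) =
      inner ℂ (evalAmp (crossedProduct α) (deltaOne Γ η) x)
        (evalAmp (crossedProduct α) (deltaOne Γ ξ) x) := by
    rw [crossedTrace_eq_inner h, inner_evalAmp_star_mul_self]
  rw [hinner]
  refine (hasSum_tsum_inner _ _).congr_fun fun g => ?_
  have hcoef : τ (star (coef x g) * coef x g) =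
      inner ℂ (evalAmp B η (coef x g)) (evalAmp B ξ (coef x g)) := by
    rw [h, inner_evalAmp_star_mul_self]
  rw [hcoef, lp.inner_eq_tsum]
  exact tsum_congr fun n => congrArg₂ (inner ℂ) (coef_apply x g (η n)) (coef_apply x g (ξ n))

theorem crossedTrace_nonneg (hτ : IsTrace B τ) (x : CrossedProduct α) :
    0 ≤ crossedTrace α τ (star x * x) :=
  (hasSum_coef hτ.normal x).nonneg fun _ => hτ.nonneg _

theorem crossedTrace_monomial_mul_comm (hτ : IsTrace B τ) (hα : ∀ g b, τ (α g b) = τ b)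
    (g h : Γ) (a b : B.toStarSubalgebra) :
    crossedTrace α τ (lamHom α g * piHom α a * (lamHom α h * piHom α b)) =
      crossedTrace α τ (lamHom α h * piHom α b * (lamHom α g * piHom α a)) := by
  classical
  rw [monomial_mul_monomial, monomial_mul_monomial, crossedTrace_lamHom_mul_piHom,
    crossedTrace_lamHom_mul_piHom]
  by_cases hgh : g * h = 1
  · obtain rfl : h = g⁻¹ := (inv_eq_of_mul_eq_one_right hgh).symm
    rw [if_pos hgh, if_pos (inv_mul_cancel g), inv_inv, ← hα g⁻¹, map_mul, act_inv_act, hτ.tracial]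
  · rw [if_neg hgh, if_neg (mt mul_eq_one_comm.1 hgh)]

theorem crossedTrace_tracial (hτ : IsTrace B τ) (hα : ∀ g b, τ (α g b) = τ b)
    (x y : CrossedProduct α) : crossedTrace α τ (x * y) = crossedTrace α τ (y * x) := by
  refine (crossedTrace_normal hτ.normal).map_mul_comm (X := monomials α)
    (fun _ => star_mem_monomials) ?_ (mem_generatedBy_monomials x) (mem_generatedBy_monomials y)
  rintro _ ⟨⟨g, a⟩, rfl⟩ _ ⟨⟨h, b⟩, rfl⟩
  exact crossedTrace_monomial_mul_comm hτ hα g h a b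

theorem crossedTrace_faithful (hτ : IsTrace B τ) (hα : ∀ g b, τ (α g b) = τ b)
    {x : CrossedProduct α} (hx : crossedTrace α τ (star x * x) = 0) : x = 0 := by
  refine eq_zero_of_coef_mul_lamHom_eq_zero fun k g => ?_
  have hzero : crossedTrace α τ (star (x * lamHom α k) * (x * lamHom α k)) = 0 := by
    rw [star_mul, crossedTrace_tracial hτ hα, star_lamHom, mul_assoc, ← mul_assoc (lamHom α k),
      lamHom_mul_lamHom_inv, one_mul, crossedTrace_tracial hτ hα, hx]
  have hsum := hasSum_coef hτ.normal (x * lamHom α k)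
  rw [hzero, hasSum_zero_iff_of_nonneg fun _ => hτ.nonneg _] at hsum
  exact hτ.faithful _ (congrFun hsum g)

theorem crossedTrace_isTrace (hτ : IsTrace B τ) (hα : ∀ g b, τ (α g b) = τ b) :
    IsTrace (crossedProduct α) (crossedTrace α τ) where
  normal := crossedTrace_normal hτ.normal
  nonneg := crossedTrace_nonneg hτ
  faithful _ := crossedTrace_faithful hτ hα
  tracial := crossedTrace_tracial hτ hα
  normalised := by rw [← map_one (piHom α), crossedTrace_piHom, hτ.normalised]

end CrossedTrace

section FourierCoefficients

variable {Γ K : Type*} [Group Γ] [NormedAddCommGroup K] [InnerProductSpace ℂ K] [CompleteSpace K]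
  {B : VonNeumannAlgebra K} {α : Γ →* (B.toStarSubalgebra ≃⋆ₐ[ℂ] B.toStarSubalgebra)}
  {τ : B.toStarSubalgebra →ₗ[ℂ] ℂ}

/-- The functional `x ↦ τ(x(g))`, giving the coefficient of `E(x)` at `λ(g)` when `E` is the
conditional expectation onto `L(Γ)`. -/
def groupCoeff (τ : B.toStarSubalgebra →ₗ[ℂ] ℂ) (g : Γ) : CrossedProduct α →ₗ[ℂ] ℂ :=
  crossedTrace α τ ∘ₗ LinearMap.mulLeft ℂ (lamHom α g⁻¹)

theorem groupCoeff_apply (g : Γ) (x : CrossedProduct α) : groupCoeff τ g x = τ (coef x g) := rfl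

theorem groupCoeff_eq_crossedTrace (g : Γ) (x : CrossedProduct α) :
    groupCoeff τ g x = crossedTrace α τ (lamHom α g⁻¹ * x) := rfl

open scoped Classical in
theorem groupCoeff_lamHom (hτ : IsTrace B τ) (g k : Γ) :
    groupCoeff τ g (lamHom α k) = if g = k then 1 else 0 := by
  rw [groupCoeff_eq_crossedTrace, ← map_mul, ← mul_one (lamHom α _), ← map_one (piHom α),
    crossedTrace_lamHom_mul_piHom, hτ.normalised]
  exact if_congr inv_mul_eq_one rfl rfl

theorem coef_piHom_mul (b : B.toStarSubalgebra) (x : CrossedProduct α) (g : Γ) :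
    coef (piHom α b * x) g = α g⁻¹ b * coef x g := by
  classical
  refine Subtype.ext (ContinuousLinearMap.ext fun v => ?_)
  rw [coef_apply]
  exact congrArg ((α g⁻¹ b : B.toStarSubalgebra) : K →L[ℂ] K) (coef_apply x g v).symm

theorem crossedTrace_piHom_mul (hτ : IsTrace B τ) (hα : ∀ g b, τ (α g b) = τ b)
    (b : B.toStarSubalgebra) {v : CrossedProduct α}
    (hv : (v : L2 Γ K →L[ℂ] L2 Γ K) ∈ groupVN Γ K) :
    crossedTrace α τ (piHom α b * v) = τ b * crossedTrace α τ v := by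
  classical
  have hT := crossedTrace_normal (α := α) hτ.normal
  refine (hT.comp_mulLeft (piHom α b)).eq_of_eqOn (hT.const_smul (τ b))
    (fun _ => star_mem_mrange_lamHom) ?_ (mem_generatedBy_mrange_lamHom hv)
  rintro _ ⟨g, rfl⟩
  change crossedTrace α τ (piHom α b * lamHom α g) = τ b * crossedTrace α τ (lamHom α g)
  rw [piHom_mul_lamHom, crossedTrace_lamHom_mul_piHom, hα, ← mul_one (lamHom α g),
    ← map_one (piHom α), crossedTrace_lamHom_mul_piHom, hτ.normalised, mul_ite, mul_one, mul_zero]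

theorem groupCoeff_piHom_mul (hτ : IsTrace B τ) (hα : ∀ g b, τ (α g b) = τ b)
    (b : B.toStarSubalgebra) {v : CrossedProduct α}
    (hv : (v : L2 Γ K →L[ℂ] L2 Γ K) ∈ groupVN Γ K) (g : Γ) :
    groupCoeff τ g (piHom α b * v) = τ b * groupCoeff τ g v := by
  have hmem : ((lamHom α g⁻¹ * v : CrossedProduct α) : L2 Γ K →L[ℂ] L2 Γ K) ∈ groupVN Γ K :=
    mul_mem (lamHom_mem_groupVN g⁻¹) hv
  rw [groupCoeff_eq_crossedTrace, ← mul_assoc, lamHom_mul_piHom, mul_assoc,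
    crossedTrace_piHom_mul hτ hα _ hmem, hα, groupCoeff_eq_crossedTrace]

theorem coef_eq_smul_one (hτ : IsTrace B τ) (hα : ∀ g b, τ (α g b) = τ b)
    {v : CrossedProduct α} (hv : (v : L2 Γ K →L[ℂ] L2 Γ K) ∈ groupVN Γ K) (g : Γ) :
    coef v g = groupCoeff τ g v • (1 : B.toStarSubalgebra) := by
  have hfactor (b : B.toStarSubalgebra) : τ (b * coef v g) = τ b * groupCoeff τ g v := by
    rw [← hα g b, ← groupCoeff_piHom_mul hτ hα _ hv, groupCoeff_apply, coef_piHom_mul, act_inv_act]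
  refine sub_eq_zero.1 (hτ.faithful _ ?_)
  rw [mul_sub, map_sub, hfactor, mul_smul_comm, mul_one, map_smul, smul_eq_mul, mul_comm, sub_self]

theorem hasSum_norm₂_sq_coef (hτ : IsTrace B τ) (x : CrossedProduct α) :
    HasSum (fun g => norm₂ τ (coef x g) ^ 2) (norm₂ (crossedTrace α τ) x ^ 2) := by
  rw [norm₂_sq (crossedTrace_nonneg hτ)]
  exact (Complex.hasSum_re (hasSum_coef hτ.normal x)).congr_fun fun g => norm₂_sq hτ.nonneg _

theorem norm_sq_groupCoeff_le (hτ : IsTrace B τ) (x : CrossedProduct α) (g : Γ) :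
    ‖groupCoeff τ g x‖ ^ 2 ≤ norm₂ τ (coef x g) ^ 2 :=
  pow_le_pow_left₀ (norm_nonneg _) (hτ.norm_map_le _) 2

theorem sum_norm_sq_groupCoeff_le (hτ : IsTrace B τ) (x : CrossedProduct α) (s : Finset Γ) :
    ∑ g ∈ s, ‖groupCoeff τ g x‖ ^ 2 ≤ norm₂ (crossedTrace α τ) x ^ 2 :=
  (Finset.sum_le_sum fun g _ => norm_sq_groupCoeff_le hτ x g).trans
    (sum_le_hasSum s (fun _ _ => sq_nonneg _) (hasSum_norm₂_sq_coef hτ x))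

theorem hasSum_norm_sq_groupCoeff (hτ : IsTrace B τ) (hα : ∀ g b, τ (α g b) = τ b)
    {v : CrossedProduct α} (hv : (v : L2 Γ K →L[ℂ] L2 Γ K) ∈ groupVN Γ K) :
    HasSum (fun g => ‖groupCoeff τ g v‖ ^ 2) (norm₂ (crossedTrace α τ) v ^ 2) := by
  refine (hasSum_norm₂_sq_coef hτ v).congr_fun fun g => ?_
  rw [coef_eq_smul_one hτ hα hv g, norm₂_smul, hτ.norm₂_one, mul_one]

theorem tendsto_groupCoeff (hτ : IsTrace B τ) (x : CrossedProduct α) :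
    Tendsto (fun g => groupCoeff τ g x) cofinite (𝓝 0) := by
  have hsq : Tendsto (fun g => ‖groupCoeff τ g x‖ ^ 2) cofinite (𝓝 0) :=
    (Summable.of_nonneg_of_le (fun _ => sq_nonneg _) (norm_sq_groupCoeff_le hτ x)
      (hasSum_norm₂_sq_coef hτ x).summable).tendsto_cofinite_zero
  refine tendsto_zero_iff_norm_tendsto_zero.2 ?_
  simpa only [Real.sqrt_sq (norm_nonneg _), Real.sqrt_zero] using hsq.sqrt

end FourierCoefficients

section NecessityOfMixing

variable {Γ K : Type*} [Group Γ] [NormedAddCommGroup K] [InnerProductSpace ℂ K] [CompleteSpace K]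
  {B : VonNeumannAlgebra K} {α : Γ →* (B.toStarSubalgebra ≃⋆ₐ[ℂ] B.toStarSubalgebra)}
  {τ : B.toStarSubalgebra →ₗ[ℂ] ℂ}

theorem stronglyMixingAction_iff :
    StronglyMixingAction α τ ↔
      ∀ a b, Tendsto (fun g => τ (α g a * b) - τ a * τ b) cofinite (𝓝 0) := by
  classical
  simp only [Metric.tendsto_nhds, dist_zero_right, eventually_cofinite]
  constructor
  · intro h a b ε hε
    obtain ⟨E, hE⟩ := h {a, b} ε hε
    refine E.finite_toSet.subset fun g hg => by_contra fun hgE => hg ?_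
    exact hE a (Finset.mem_insert_self a _) b
      (Finset.mem_insert_of_mem (Finset.mem_singleton_self b)) g hgE
  · intro h F ε hε
    have hfin : {g | ¬∀ a ∈ F, ∀ b ∈ F, ‖τ (α g a * b) - τ a * τ b‖ < ε}.Finite := by
      simp only [← eventually_cofinite, eventually_all_finset] at h ⊢
      exact fun a _ b _ => h a b ε hε
    exact ⟨hfin.toFinset, fun a ha b hb g hg =>
      not_not.1 (mt hfin.mem_toFinset.2 hg) a ha b hb⟩

theorem lamUnitary_injective (hτ : IsTrace B τ) : Function.Injective (lamUnitary α) := by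
  classical
  intro g h hgh
  have hcoe : lamHom α g = lamHom α h := congrArg Subtype.val hgh
  have hcoeff := groupCoeff_lamHom (α := α) hτ g h
  rw [← hcoe, groupCoeff_lamHom hτ, if_pos rfl] at hcoeff
  exact by_contra fun hne => one_ne_zero (hcoeff.trans (if_neg hne))

theorem almostOrthonormal_range_lamUnitary [Infinite Γ] (hτ : IsTrace B τ) :
    AlmostOrthonormal (crossedTrace α τ)
      ((lamUnitary α).range : Set (unitary (CrossedProduct α))) := by
  refine ⟨Set.infinite_range_of_injective (lamUnitary_injective hτ), fun x ε hε => ?_⟩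
  have hlim : Tendsto (fun g => groupCoeff τ g⁻¹ x) cofinite (𝓝 0) :=
    (tendsto_groupCoeff hτ x).comp inv_injective.tendsto_cofinite
  have hfin : {g | ¬‖groupCoeff τ g⁻¹ x‖ ≤ ε}.Finite :=
    eventually_cofinite.1 (hlim.norm.eventually_le_const (norm_zero.trans_lt hε))
  refine ⟨_, hfin.image (lamUnitary α), Set.image_subset_range _ _, ?_⟩
  rintro _ ⟨⟨g, rfl⟩, hg⟩
  have hle : ‖groupCoeff τ g⁻¹ x‖ ≤ ε := by_contra fun hlt => hg ⟨g, hlt, rfl⟩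
  rwa [groupCoeff_eq_crossedTrace, inv_inv] at hle

theorem norm_correlation_le (hτ : IsTrace B τ) (hα : ∀ g b, τ (α g b) = τ b)
    {E : CrossedProduct α → CrossedProduct α}
    (hE : IsCondExp (crossedTrace α τ) (groupVN Γ K) E) (a b : B.toStarSubalgebra) (g : Γ) :
    ‖τ (α g a * b) - τ a * τ b‖ ≤ norm₂ (crossedTrace α τ)
      (E (lamHom α g * piHom α a * lamHom α g⁻¹ * piHom α b) - E (piHom α a) * E (piHom α b)) := by
  have hconj : lamHom α g * piHom α a * lamHom α g⁻¹ * piHom α b = piHom α (α g a * b) := by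
    rw [lamHom_mul_piHom, mul_assoc (piHom α _), lamHom_mul_lamHom_inv, mul_one, map_mul]
  have htrace : crossedTrace α τ (E (piHom α (α g a * b)) - E (piHom α a) * E (piHom α b)) =
      τ (α g a * b) - τ a * τ b := by
    rw [map_sub, hE.map_apply, crossedTrace_piHom, hE.2 _ _ (hE.1 _),
      crossedTrace_piHom_mul hτ hα a (hE.1 _), hE.map_apply, crossedTrace_piHom]
  rw [hconj, ← htrace]
  exact (crossedTrace_isTrace hτ hα).norm_map_le _

theorem stronglyMixingAction_of_stronglyMixingIn (hτ : IsTrace B τ)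
    (hα : ∀ g b, τ (α g b) = τ b)
    (h : StronglyMixingIn (crossedTrace α τ) (groupVN Γ K)) : StronglyMixingAction α τ := by
  obtain ⟨E, hE, hmix⟩ := h
  refine stronglyMixingAction_iff.2 fun a b => ?_
  rcases finite_or_infinite Γ with _ | _
  · rw [cofinite_eq_bot]
    exact tendsto_bot
  have hG : ∀ u ∈ (lamUnitary α).range, ((u : CrossedProduct α) : L2 Γ K →L[ℂ] L2 Γ K) ∈
      groupVN Γ K := by
    rintro _ ⟨g, rfl⟩
    exact lamHom_mem_groupVN g
  have hlim := hmix (lamUnitary α).range hG (almostOrthonormal_range_lamUnitary hτ) (piHom α a)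
    (piHom α b)
  have hinj : Function.Injective (lamUnitary α).rangeRestrict :=
    MonoidHom.rangeRestrict_injective_iff.2 (lamUnitary_injective hτ)
  refine squeeze_zero_norm (fun g => ?_) (hlim.comp hinj.tendsto_cofinite)
  refine (norm_correlation_le hτ hα hE a b g).trans_eq ?_
  rw [← star_lamHom]
  rfl

end NecessityOfMixing

section Convolution

variable {Γ K : Type*} [Group Γ]

/-- Boundedness by `C` of the left convolution by `f` on the finitely supported functions in
`ℓ²(Γ)`, stated through finite sums so that no operator has to be constructed first. -/
def IsConvBounded (f : Γ → ℂ) (C : ℝ) : Prop :=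
  ∀ (ψ : Γ → ℂ) (F s : Finset Γ),
    ∑ g ∈ s, ‖∑ k ∈ F, f (g * k⁻¹) * ψ k‖ ^ 2 ≤ C ^ 2 * ∑ k ∈ F, ‖ψ k‖ ^ 2

variable [NormedAddCommGroup K] [InnerProductSpace ℂ K]

theorem commute_lam_apply_single [DecidableEq Γ] {c : L2 Γ K →L[ℂ] L2 Γ K} {k : Γ}
    (hc : Commute (lam K k) c) (v : K) (g : Γ) :
    c (lp.single 2 k v) g = c (lp.single 2 1 v) (k⁻¹ * g) := by
  rw [← mul_one k, ← lam_single, mul_one]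
  exact congrArg (fun ζ : L2 Γ K => ζ g) (DFunLike.congr_fun hc.eq (lp.single 2 1 v)).symm

namespace IsConvBounded

variable [CompleteSpace K] {f : Γ → ℂ} {C : ℝ}

theorem summable_sq (hf : IsConvBounded f C) : Summable fun g => ‖f g‖ ^ 2 := by
  refine summable_of_sum_le (c := C ^ 2) (fun _ => sq_nonneg _) fun s => ?_
  simpa using hf (fun _ => 1) {1} s

theorem summable_smul (hf : IsConvBounded f C) (ξ : L2 Γ K) (g : Γ) :
    Summable fun k => f (g * k⁻¹) • ξ k := by
  have hker : Summable fun k => ‖f (g * k⁻¹)‖ ^ 2 :=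
    hf.summable_sq.comp_injective ((mul_right_injective g).comp inv_injective)
  refine Summable.of_norm_bounded (hker.add (hasSum_norm_sq ξ).summable) fun k => ?_
  rw [norm_smul]
  nlinarith [sq_nonneg (‖f (g * k⁻¹)‖ - ‖ξ k‖), sq_nonneg ‖f (g * k⁻¹)‖, sq_nonneg ‖ξ k‖]

theorem sum_norm_sq_le (hf : IsConvBounded f C) (ψ : Γ → K) (F s : Finset Γ) :
    ∑ g ∈ s, ‖∑ k ∈ F, f (g * k⁻¹) • ψ k‖ ^ 2 ≤ C ^ 2 * ∑ k ∈ F, ‖ψ k‖ ^ 2 := by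
  obtain ⟨w, b, -⟩ := exists_hilbertBasis ℂ K
  have parseval (v : K) : HasSum (fun i => ‖b.repr v i‖ ^ 2) (‖v‖ ^ 2) := by
    rw [← b.repr.norm_map v]
    exact hasSum_norm_sq (b.repr v)
  refine hasSum_le (fun i => ?_) (hasSum_sum fun g _ => parseval (∑ k ∈ F, f (g * k⁻¹) • ψ k))
    ((hasSum_sum fun k _ => parseval (ψ k)).mul_left (C ^ 2))
  have hcoord := hf (fun k => b.repr (ψ k) i) F s
  simpa only [map_sum, map_smul, lp.coeFn_sum, Finset.sum_apply, lp.coeFn_smul, Pi.smul_apply,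
    smul_eq_mul] using hcoord

theorem sum_norm_sq_tsum_le (hf : IsConvBounded f C) (ξ : L2 Γ K) (s : Finset Γ) :
    ∑ g ∈ s, ‖∑' k, f (g * k⁻¹) • ξ k‖ ^ 2 ≤ C ^ 2 * ‖ξ‖ ^ 2 := by
  refine le_of_tendsto_of_tendsto
    (tendsto_finsetSum s fun g _ => ((hf.summable_smul ξ g).hasSum.norm.pow 2))
    ((hasSum_norm_sq ξ).mul_left (C ^ 2)) (Eventually.of_forall fun F => ?_)
  simpa only [Finset.mul_sum] using hf.sum_norm_sq_le (fun k => ξ k) F s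

/-- Left convolution by `f` as an operator on `ℓ²(Γ, K)`. -/
def convOp (hf : IsConvBounded f C) : L2 Γ K →L[ℂ] L2 Γ K :=
  LinearMap.mkContinuous
    { toFun := fun ξ => toL2 (fun g => ∑' k, f (g * k⁻¹) • ξ k)
        (summable_of_sum_le (fun _ => sq_nonneg _) (hf.sum_norm_sq_tsum_le ξ))
      map_add' := fun ξ η => lp.ext <| funext fun g =>
        (tsum_congr fun k => smul_add (f (g * k⁻¹)) (ξ k) (η k)).trans
          ((hf.summable_smul ξ g).tsum_add (hf.summable_smul η g))
      map_smul' := fun c ξ => lp.ext <| funext fun g =>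
        (tsum_congr fun k => smul_comm (f (g * k⁻¹)) c (ξ k)).trans
          ((hf.summable_smul ξ g).tsum_const_smul c) } |C| fun ξ => by
    refine le_of_sq_le_sq ?_ (by positivity)
    rw [mul_pow, sq_abs]
    exact hasSum_le_of_sum_le (hasSum_norm_sq _) (hf.sum_norm_sq_tsum_le ξ)

theorem convOp_apply (hf : IsConvBounded f C) (ξ : L2 Γ K) (g : Γ) :
    hf.convOp ξ g = ∑' k, f (g * k⁻¹) • ξ k := rfl

theorem convOp_single [DecidableEq Γ] (hf : IsConvBounded f C) (h : Γ) (v : K) (g : Γ) :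
    hf.convOp (lp.single 2 h v) g = f (g * h⁻¹) • v := by
  rw [convOp_apply, tsum_eq_single h, lp.single_apply_self]
  intro k hk
  rw [lp.single_apply_ne _ _ _ hk, smul_zero]

theorem convOp_mem_groupVN (hf : IsConvBounded f C) : hf.convOp ∈ groupVN Γ K := by
  classical
  refine mem_generatedBy_iff.2 fun c hc => ?_
  have hlam (k : Γ) : Commute (lam K k) c := (hc (lam K k) ⟨k, rfl⟩).1
  refine lp.ext_continuousLinearMap ENNReal.ofNat_ne_top fun h => ?_
  refine ContinuousLinearMap.ext fun v => lp.ext <| funext fun g => ?_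
  have hleft : HasSum (fun k => f (k * h⁻¹) • c (lp.single 2 1 v) (k⁻¹ * g))
      (c (hf.convOp (lp.single 2 h v)) g) := by
    refine (((lp.hasSum_single ENNReal.ofNat_ne_top (hf.convOp (lp.single 2 h v))).mapL c).mapL
      (lp.evalCLM ℂ (fun _ : Γ => K) 2 g)).congr_fun fun k => ?_
    rw [convOp_single, lp.single_smul, map_smul, map_smul]
    exact congrArg (f (k * h⁻¹) • ·) (commute_lam_apply_single (hlam k) v g).symm
  have hright : HasSum (fun k => f (g * k⁻¹) • c (lp.single 2 1 v) (h⁻¹ * k))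
      (hf.convOp (c (lp.single 2 h v)) g) := by
    refine (hf.summable_smul (c (lp.single 2 h v)) g).hasSum.congr_fun fun k => ?_
    rw [commute_lam_apply_single (hlam h)]
  let e : Γ ≃ Γ := (Equiv.inv Γ).trans ((Equiv.mulRight g).trans (Equiv.mulLeft h))
  refine hleft.unique ((e.hasSum_iff.2 hright).congr_fun fun k => ?_)
  change f (k * h⁻¹) • c (lp.single 2 1 v) (k⁻¹ * g) =
    f (g * (h * (k⁻¹ * g))⁻¹) • c (lp.single 2 1 v) (h⁻¹ * (h * (k⁻¹ * g)))
  rw [inv_mul_cancel_left, mul_inv_rev, mul_inv_rev, inv_inv, mul_assoc g⁻¹, mul_inv_cancel_left]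

end IsConvBounded

end Convolution

section ConditionalExpectation

variable {Γ K : Type*} [Group Γ] [NormedAddCommGroup K] [InnerProductSpace ℂ K] [CompleteSpace K]
  {B : VonNeumannAlgebra K} {α : Γ →* (B.toStarSubalgebra ≃⋆ₐ[ℂ] B.toStarSubalgebra)}
  {τ : B.toStarSubalgebra →ₗ[ℂ] ℂ}

theorem groupCoeff_mul_lamHom (hτ : IsTrace B τ) (hα : ∀ g b, τ (α g b) = τ b)
    (x : CrossedProduct α) (g k : Γ) :
    groupCoeff τ g (x * lamHom α k) = groupCoeff τ (g * k⁻¹) x := by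
  rw [groupCoeff_eq_crossedTrace, groupCoeff_eq_crossedTrace, ← mul_assoc,
    crossedTrace_tracial hτ hα, ← mul_assoc, ← map_mul, mul_inv_rev, inv_inv]

theorem norm₂_sum_smul_lamHom_sq (hτ : IsTrace B τ) (hα : ∀ g b, τ (α g b) = τ b) (ψ : Γ → ℂ)
    (F : Finset Γ) :
    norm₂ (crossedTrace α τ) (∑ k ∈ F, ψ k • lamHom α k) ^ 2 = ∑ k ∈ F, ‖ψ k‖ ^ 2 := by
  classical
  have hmem : ((∑ k ∈ F, ψ k • lamHom α k : CrossedProduct α) : L2 Γ K →L[ℂ] L2 Γ K) ∈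
      groupVN Γ K := by
    rw [AddSubmonoidClass.coe_finsetSum]
    exact sum_mem fun k _ =>
      (groupVN Γ K).toStarSubalgebra.smul_mem (lamHom_mem_groupVN (α := α) k) (ψ k)
  have hcoeff (g : Γ) : groupCoeff τ g (∑ k ∈ F, ψ k • lamHom α k) = if g ∈ F then ψ g else 0 := by
    simp only [map_sum, map_smul, groupCoeff_lamHom hτ, smul_eq_mul, mul_ite, mul_one, mul_zero,
      Finset.sum_ite_eq]
  have hsum : HasSum (fun g => if g ∈ F then ‖ψ g‖ ^ 2 else 0) (∑ g ∈ F, ‖ψ g‖ ^ 2) := by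
    rw [← Finset.sum_congr rfl fun g hg => if_pos hg]
    exact hasSum_sum_of_ne_finset_zero fun g hg => if_neg hg
  refine (hasSum_norm_sq_groupCoeff hτ hα hmem).unique (hsum.congr_fun fun g => ?_)
  rw [hcoeff, apply_ite (‖·‖ ^ 2), norm_zero, zero_pow two_ne_zero]

theorem isConvBounded_groupCoeff (hτ : IsTrace B τ) (hα : ∀ g b, τ (α g b) = τ b)
    (x : CrossedProduct α) : IsConvBounded (fun g => groupCoeff τ g x) ‖x‖ := by
  intro ψ F s
  have hconv (g : Γ) : ∑ k ∈ F, groupCoeff τ (g * k⁻¹) x * ψ k =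
      groupCoeff τ g (x * ∑ k ∈ F, ψ k • lamHom α k) := by
    simp only [Finset.mul_sum, map_sum, mul_smul_comm, map_smul, groupCoeff_mul_lamHom hτ hα,
      smul_eq_mul, mul_comm]
  simp only [hconv]
  refine (sum_norm_sq_groupCoeff_le hτ _ s).trans ?_
  rw [← norm₂_sum_smul_lamHom_sq (α := α) hτ hα, ← mul_pow]
  exact pow_le_pow_left₀ (norm₂_nonneg _) (norm₂_mul_le_norm_mul (crossedTrace_nonneg hτ) _ _) 2

/-- The trace preserving conditional expectation of the crossed product onto `L(Γ)`, sending `x` to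
the convolution operator of its Fourier coefficients `τ(x(g))`. -/
def condExp (hτ : IsTrace B τ) (hα : ∀ g b, τ (α g b) = τ b) (x : CrossedProduct α) :
    CrossedProduct α :=
  ⟨(isConvBounded_groupCoeff hτ hα x).convOp,
    generatedBy_mono Set.subset_union_right (IsConvBounded.convOp_mem_groupVN _)⟩

theorem coef_condExp (hτ : IsTrace B τ) (hα : ∀ g b, τ (α g b) = τ b) (x : CrossedProduct α)
    (g : Γ) : coef (condExp hτ hα x) g = groupCoeff τ g x • (1 : B.toStarSubalgebra) := by
  classical
  refine Subtype.ext (ContinuousLinearMap.ext fun v => ?_)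
  rw [coef_apply]
  refine (IsConvBounded.convOp_single _ _ _ _).trans ?_
  rw [inv_one, mul_one]
  rfl

theorem groupCoeff_condExp (hτ : IsTrace B τ) (hα : ∀ g b, τ (α g b) = τ b)
    (x : CrossedProduct α) (g : Γ) : groupCoeff τ g (condExp hτ hα x) = groupCoeff τ g x := by
  rw [groupCoeff_apply, coef_condExp, map_smul, hτ.normalised, smul_eq_mul, mul_one]

theorem isCondExp_condExp (hτ : IsTrace B τ) (hα : ∀ g b, τ (α g b) = τ b) :
    IsCondExp (crossedTrace α τ) (groupVN Γ K) (condExp (α := α) hτ hα) := by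
  refine ⟨fun x => IsConvBounded.convOp_mem_groupVN _, fun x a ha => ?_⟩
  have hT := crossedTrace_normal (α := α) hτ.normal
  refine (hT.comp_mulLeft (condExp hτ hα x)).eq_of_eqOn (hT.comp_mulLeft x)
    (fun _ => star_mem_mrange_lamHom) ?_ (mem_generatedBy_mrange_lamHom ha)
  rintro _ ⟨g, rfl⟩
  have hcoeff := groupCoeff_condExp hτ hα x g⁻¹
  rw [groupCoeff_eq_crossedTrace, groupCoeff_eq_crossedTrace, inv_inv,
    crossedTrace_tracial hτ hα, crossedTrace_tracial hτ hα _ x] at hcoeff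
  exact hcoeff

end ConditionalExpectation

section Limits

theorem tendsto_zero_of_approx {ι : Type*} {l : Filter ι} {f : ι → ℝ} (hf : ∀ i, 0 ≤ f i)
    (h : ∀ ε > 0, ∃ f' : ι → ℝ, Tendsto f' l (𝓝 0) ∧ ∀ i, f i ≤ f' i + ε) :
    Tendsto f l (𝓝 0) := by
  refine tendsto_order.2 ⟨fun a ha => Eventually.of_forall fun i => ha.trans_le (hf i),
    fun ε hε => ?_⟩
  obtain ⟨f', hf', hle⟩ := h (ε / 2) (half_pos hε)
  filter_upwards [hf'.eventually_lt_const (half_pos hε)] with i hi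
  linarith [hle i]

theorem tendsto_weighted_sum_zero {ι κ : Type*} {l : Filter ι} {p : ι → κ → ℝ} {q : κ → ℝ}
    {S : ι → ℝ} (hp : ∀ i g, 0 ≤ p i g) (hp_sum : ∀ i, HasSum (p i) 1)
    (hp_lim : ∀ g, Tendsto (fun i => p i g) l (𝓝 0)) (hq : ∀ g, 0 ≤ q g)
    (hq_lim : Tendsto q cofinite (𝓝 0)) (hS : ∀ i, HasSum (fun g => p i g * q g) (S i)) :
    Tendsto S l (𝓝 0) := by
  classical
  refine tendsto_zero_of_approx (fun i => (hS i).nonneg fun g => mul_nonneg (hp i g) (hq g))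
    fun ε hε => ?_
  have hfin : {g | ¬q g < ε}.Finite := eventually_cofinite.1 (hq_lim.eventually_lt_const hε)
  refine ⟨fun i => ∑ g ∈ hfin.toFinset, p i g * q g, ?_, fun i => ?_⟩
  · simpa only [zero_mul, Finset.sum_const_zero] using
      tendsto_finsetSum hfin.toFinset fun g _ => (hp_lim g).mul_const (q g)
  · have hbound : HasSum (fun g => (if g ∈ hfin.toFinset then p i g * q g else 0) + p i g * ε)
        (∑ g ∈ hfin.toFinset, p i g * q g + 1 * ε) := by
      refine HasSum.add ?_ ((hp_sum i).mul_right ε)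
      rw [← Finset.sum_congr rfl fun g hg => if_pos hg]
      exact hasSum_sum_of_ne_finset_zero fun g hg => if_neg hg
    rw [one_mul] at hbound
    refine hasSum_le (fun g => ?_) (hS i) hbound
    split_ifs with hg
    · exact le_add_of_nonneg_right (mul_nonneg (hp i g) hε.le)
    · rw [zero_add]
      exact mul_le_mul_of_nonneg_left (not_le.1 fun hle => hg (hfin.mem_toFinset.2 hle.not_gt)).le
        (hp i g)

theorem tendsto_seminorm_of_span {V ι : Type*} [AddCommGroup V] [Module ℂ V] (p : Seminorm ℂ V)
    {l : Filter ι} (D : ι → V →ₗ[ℂ] V) {C : ℝ} (hC : ∀ i x, p (D i x) ≤ C * p x) {Z : Set V}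
    (hZ : ∀ z ∈ Z, Tendsto (fun i => p (D i z)) l (𝓝 0)) {x : V}
    (hx : ∀ ε > 0, ∃ z ∈ Submodule.span ℂ Z, p (x - z) < ε) :
    Tendsto (fun i => p (D i x)) l (𝓝 0) := by
  have hspan (z : V) (hz : z ∈ Submodule.span ℂ Z) : Tendsto (fun i => p (D i z)) l (𝓝 0) := by
    induction hz using Submodule.span_induction with
    | mem z hz => exact hZ z hz
    | zero => simp only [map_zero, tendsto_const_nhds]
    | add y z _ _ hy hz =>
      refine squeeze_zero (fun i => apply_nonneg p _) (fun i => ?_) (by simpa using hy.add hz)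
      rw [map_add]
      exact map_add_le_add p _ _
    | smul c z _ hz => simpa only [map_smul, map_smul_eq_mul, mul_zero] using hz.const_mul ‖c‖
  refine tendsto_zero_of_approx (fun i => apply_nonneg p _) fun ε hε => ?_
  have hpos : 0 < |C| + 1 := by positivity
  obtain ⟨z, hz, hlt⟩ := hx (ε / (|C| + 1)) (by positivity)
  refine ⟨_, hspan z hz, fun i => ?_⟩
  calc p (D i x) = p (D i z + D i (x - z)) := by rw [← map_add, add_sub_cancel]
    _ ≤ p (D i z) + p (D i (x - z)) := map_add_le_add p _ _
    _ ≤ p (D i z) + (|C| + 1) * (ε / (|C| + 1)) := by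
      gcongr
      exact (hC i _).trans (mul_le_mul (by linarith [le_abs_self C]) hlt.le (apply_nonneg p _)
        hpos.le)
    _ = p (D i z) + ε := by rw [mul_div_cancel₀ _ hpos.ne']

end Limits

section Defect

variable {H : Type*} [NormedAddCommGroup H] [InnerProductSpace ℂ H] [CompleteSpace H]
  {M : VonNeumannAlgebra H} {τ : M.toStarSubalgebra →ₗ[ℂ] ℂ} {A : VonNeumannAlgebra H}
  {E : M.toStarSubalgebra → M.toStarSubalgebra}

/-- The bilinear map `(x, y) ↦ E(u x u⁻¹ y) - E(x) E(y)`, measuring the failure of `u` to mix. -/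
def defect (hE : IsCondExp τ A E) (hτ : IsTrace M τ) (u : unitary M.toStarSubalgebra) :
    M.toStarSubalgebra →ₗ[ℂ] M.toStarSubalgebra →ₗ[ℂ] M.toStarSubalgebra :=
  (LinearMap.mul ℂ M.toStarSubalgebra ∘ₗ LinearMap.mulRight ℂ ↑u⁻¹ ∘ₗ
    LinearMap.mulLeft ℂ ↑u).compr₂ (hE.toLinearMap hτ) -
    (LinearMap.mul ℂ M.toStarSubalgebra).compl₁₂ (hE.toLinearMap hτ) (hE.toLinearMap hτ)

theorem defect_apply (hE : IsCondExp τ A E) (hτ : IsTrace M τ) (u : unitary M.toStarSubalgebra)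
    (x y : M.toStarSubalgebra) : defect hE hτ u x y =
      E ((u : M.toStarSubalgebra) * x * (u⁻¹ : unitary M.toStarSubalgebra) * y) - E x * E y :=
  rfl

theorem defect_mul_left (hE : IsCondExp τ A E) (hτ : IsTrace M τ) {u : unitary M.toStarSubalgebra}
    {a : M.toStarSubalgebra} (ha : (a : H →L[ℂ] H) ∈ A) (hau : Commute a u)
    (x y : M.toStarSubalgebra) : defect hE hτ u (a * x) y = a * defect hE hτ u x y := by
  rw [defect_apply, ← mul_assoc (u : M.toStarSubalgebra) a, ← hau.eq, defect_apply, mul_sub,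
    ← hE.map_mul_left hτ ha, hE.map_mul_left hτ ha x]
  simp only [mul_assoc]

theorem defect_mul_right (hE : IsCondExp τ A E) (hτ : IsTrace M τ) {u : unitary M.toStarSubalgebra}
    {a : M.toStarSubalgebra} (ha : (a : H →L[ℂ] H) ∈ A) (x y : M.toStarSubalgebra) :
    defect hE hτ u x (y * a) = defect hE hτ u x y * a := by
  rw [defect_apply, ← mul_assoc, hE.map_mul_right hτ ha, hE.map_mul_right hτ ha, defect_apply,
    sub_mul, mul_assoc (E x)]

theorem norm₂_defect_le_right (hE : IsCondExp τ A E) (hτ : IsTrace M τ)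
    (u : unitary M.toStarSubalgebra) (x y : M.toStarSubalgebra) :
    norm₂ τ (defect hE hτ u x y) ≤ (‖x‖ + ‖E x‖) * norm₂ τ y := by
  have hconj : norm₂ τ ((u : M.toStarSubalgebra) * x * (u⁻¹ : unitary M.toStarSubalgebra) * y) ≤
      ‖x‖ * norm₂ τ y := by
    rw [mul_assoc, mul_assoc, norm₂_mul_of_star_mul_self (Unitary.coe_star_mul_self u),
      ← norm₂_mul_of_star_mul_self (Unitary.coe_star_mul_self u⁻¹) y]
    exact norm₂_mul_le_norm_mul hτ.nonneg _ _
  have hprod : norm₂ τ (E x * E y) ≤ ‖E x‖ * norm₂ τ y :=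
    (norm₂_mul_le_norm_mul hτ.nonneg _ _).trans
      (mul_le_mul_of_nonneg_left (hE.norm₂_le hτ y) (norm_nonneg _))
  rw [add_mul]
  exact (norm₂_sub_le hτ.nonneg _ _).trans (add_le_add ((hE.norm₂_le hτ _).trans hconj) hprod)

theorem norm₂_defect_le_left (hE : IsCondExp τ A E) (hτ : IsTrace M τ)
    (u : unitary M.toStarSubalgebra) (x y : M.toStarSubalgebra) :
    norm₂ τ (defect hE hτ u x y) ≤ (‖y‖ + ‖E y‖) * norm₂ τ x := by
  have hconj : norm₂ τ ((u : M.toStarSubalgebra) * x * (u⁻¹ : unitary M.toStarSubalgebra) * y) ≤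
      norm₂ τ x * ‖y‖ := by
    refine (hτ.norm₂_mul_le_mul_norm _ _).trans_eq ?_
    rw [hτ.norm₂_mul_of_mul_star_self (Unitary.coe_mul_star_self u⁻¹),
      norm₂_mul_of_star_mul_self (Unitary.coe_star_mul_self u)]
  have hprod : norm₂ τ (E x * E y) ≤ norm₂ τ x * ‖E y‖ :=
    (hτ.norm₂_mul_le_mul_norm _ _).trans
      (mul_le_mul_of_nonneg_right (hE.norm₂_le hτ x) (norm_nonneg _))
  rw [mul_comm, mul_add]
  exact (norm₂_sub_le hτ.nonneg _ _).trans (add_le_add ((hE.norm₂_le hτ _).trans hconj) hprod)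

theorem tendsto_defect_of_span_left {ι : Type*} {l : Filter ι} {v : ι → unitary M.toStarSubalgebra}
    (hE : IsCondExp τ A E) (hτ : IsTrace M τ) {Z : Set M.toStarSubalgebra}
    {x y : M.toStarSubalgebra}
    (hZ : ∀ z ∈ Z, Tendsto (fun i => norm₂ τ (defect hE hτ (v i) z y)) l (𝓝 0))
    (hx : ∀ ε > 0, ∃ z ∈ Submodule.span ℂ Z, norm₂ τ (x - z) < ε) :
    Tendsto (fun i => norm₂ τ (defect hE hτ (v i) x y)) l (𝓝 0) :=
  tendsto_seminorm_of_span (seminorm₂ hτ.nonneg) (fun i => (defect hE hτ (v i)).flip y)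
    (fun i x => norm₂_defect_le_left hE hτ (v i) x y) hZ hx

theorem tendsto_defect_of_span_right {ι : Type*} {l : Filter ι} {v : ι → unitary M.toStarSubalgebra}
    (hE : IsCondExp τ A E) (hτ : IsTrace M τ) {Z : Set M.toStarSubalgebra}
    {x y : M.toStarSubalgebra}
    (hZ : ∀ z ∈ Z, Tendsto (fun i => norm₂ τ (defect hE hτ (v i) x z)) l (𝓝 0))
    (hy : ∀ ε > 0, ∃ z ∈ Submodule.span ℂ Z, norm₂ τ (y - z) < ε) :
    Tendsto (fun i => norm₂ τ (defect hE hτ (v i) x y)) l (𝓝 0) :=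
  tendsto_seminorm_of_span (seminorm₂ hτ.nonneg) (fun i => defect hE hτ (v i) x)
    (fun i y => norm₂_defect_le_right hE hτ (v i) x y) hZ hy

end Defect

section SufficiencyOfMixing

variable {Γ K : Type*} [NormedAddCommGroup K] [InnerProductSpace ℂ K] [CompleteSpace K]
  {B : VonNeumannAlgebra K}

section Group

variable [Group Γ] {α : Γ →* (B.toStarSubalgebra ≃⋆ₐ[ℂ] B.toStarSubalgebra)}
  {τ : B.toStarSubalgebra →ₗ[ℂ] ℂ} {E : CrossedProduct α → CrossedProduct α}

theorem IsCondExp.map_piHom (hE : IsCondExp (crossedTrace α τ) (groupVN Γ K) E)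
    (hτ : IsTrace B τ) (hα : ∀ g b, τ (α g b) = τ b) (b : B.toStarSubalgebra) :
    E (piHom α b) = τ b • (1 : CrossedProduct α) := by
  refine hE.eq_of_forall (crossedTrace_isTrace hτ hα)
    ((groupVN Γ K).toStarSubalgebra.smul_mem (one_mem _) _) fun v hv => ?_
  rw [crossedTrace_piHom_mul hτ hα b hv, smul_mul_assoc, one_mul, map_smul, smul_eq_mul]

theorem IsCondExp.groupCoeff_map (hE : IsCondExp (crossedTrace α τ) (groupVN Γ K) E)
    (hτ : IsTrace B τ) (hα : ∀ g b, τ (α g b) = τ b) (x : CrossedProduct α) (g : Γ) :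
    groupCoeff τ g (E x) = groupCoeff τ g x := by
  rw [groupCoeff_eq_crossedTrace, crossedTrace_tracial hτ hα, hE.2 _ _ (lamHom_mem_groupVN g⁻¹),
    crossedTrace_tracial hτ hα, groupCoeff_eq_crossedTrace]

theorem groupCoeff_piHom_mul_mul_piHom (hτ : IsTrace B τ) (hα : ∀ g b, τ (α g b) = τ b)
    (a b : B.toStarSubalgebra) {v : CrossedProduct α}
    (hv : (v : L2 Γ K →L[ℂ] L2 Γ K) ∈ groupVN Γ K) (g : Γ) :
    groupCoeff τ g (piHom α a * v * piHom α b) = τ (α g⁻¹ a * b) * groupCoeff τ g v := by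
  have hmem : ((lamHom α g⁻¹ * v : CrossedProduct α) : L2 Γ K →L[ℂ] L2 Γ K) ∈ groupVN Γ K :=
    mul_mem (lamHom_mem_groupVN g⁻¹) hv
  calc groupCoeff τ g (piHom α a * v * piHom α b)
      = crossedTrace α τ (piHom α (α g⁻¹ a) * (lamHom α g⁻¹ * v) * piHom α b) := by
        rw [groupCoeff_eq_crossedTrace, ← mul_assoc, ← mul_assoc, lamHom_mul_piHom, mul_assoc _ _ v]
    _ = crossedTrace α τ (piHom α (b * α g⁻¹ a) * (lamHom α g⁻¹ * v)) := by
        rw [crossedTrace_tracial hτ hα, ← mul_assoc, ← map_mul]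
    _ = τ (α g⁻¹ a * b) * groupCoeff τ g v := by
        rw [crossedTrace_piHom_mul hτ hα _ hmem, hτ.tracial, groupCoeff_eq_crossedTrace]

theorem norm_groupCoeff_star (hτ : IsTrace B τ) (x : CrossedProduct α) (g : Γ) :
    ‖groupCoeff τ g (star x)‖ = ‖crossedTrace α τ (x * lamHom α g)‖ := by
  rw [groupCoeff_eq_crossedTrace, ← star_lamHom, ← star_mul,
    map_star_of_nonneg (crossedTrace_nonneg hτ), RCLike.norm_conj]

variable {u : unitary (CrossedProduct α)}

theorem hasSum_norm_sq_groupCoeff_star (hτ : IsTrace B τ) (hα : ∀ g b, τ (α g b) = τ b)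
    (hu : ((u : CrossedProduct α) : L2 Γ K →L[ℂ] L2 Γ K) ∈ groupVN Γ K) :
    HasSum (fun g => ‖groupCoeff τ g (star (u : CrossedProduct α))‖ ^ 2) 1 := by
  have hT := crossedTrace_isTrace hτ hα
  have hnorm : norm₂ (crossedTrace α τ) (star (u : CrossedProduct α)) = 1 := by
    rw [hT.norm₂_star, ← mul_one (u : CrossedProduct α),
      norm₂_mul_of_star_mul_self (Unitary.coe_star_mul_self u), hT.norm₂_one]
  simpa only [hnorm, one_pow] using
    hasSum_norm_sq_groupCoeff hτ hα (v := star (u : CrossedProduct α)) (star_mem hu)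

theorem defect_piHom (hE : IsCondExp (crossedTrace α τ) (groupVN Γ K) E) (hτ : IsTrace B τ)
    (hα : ∀ g b, τ (α g b) = τ b)
    (hu : ((u : CrossedProduct α) : L2 Γ K →L[ℂ] L2 Γ K) ∈ groupVN Γ K)
    (a b : B.toStarSubalgebra) :
    defect hE (crossedTrace_isTrace hτ hα) u (piHom α a) (piHom α b) = (u : CrossedProduct α) *
      (E (piHom α a * star (u : CrossedProduct α) * piHom α b) -
        (τ a * τ b) • star (u : CrossedProduct α)) := by
  rw [mul_sub, ← hE.map_mul_left (crossedTrace_isTrace hτ hα) hu, mul_smul_comm,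
    Unitary.mul_star_self_of_mem u.2, defect_apply, hE.map_piHom hτ hα, hE.map_piHom hτ hα,
    smul_mul_smul_comm, mul_one, ← mul_assoc, ← mul_assoc]
  rfl

theorem hasSum_defect_piHom (hE : IsCondExp (crossedTrace α τ) (groupVN Γ K) E)
    (hτ : IsTrace B τ) (hα : ∀ g b, τ (α g b) = τ b)
    (hu : ((u : CrossedProduct α) : L2 Γ K →L[ℂ] L2 Γ K) ∈ groupVN Γ K)
    (a b : B.toStarSubalgebra) :
    HasSum (fun g => ‖groupCoeff τ g (star (u : CrossedProduct α))‖ ^ 2 *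
      ‖τ (α g⁻¹ a * b) - τ a * τ b‖ ^ 2) (norm₂ (crossedTrace α τ)
        (defect hE (crossedTrace_isTrace hτ hα) u (piHom α a) (piHom α b)) ^ 2) := by
  have hstar : ((star (u : CrossedProduct α) : CrossedProduct α) : L2 Γ K →L[ℂ] L2 Γ K) ∈
      groupVN Γ K := star_mem hu
  rw [defect_piHom hE hτ hα hu, norm₂_mul_of_star_mul_self (Unitary.coe_star_mul_self u)]
  refine (hasSum_norm_sq_groupCoeff hτ hα (sub_mem (hE.1 _)
    ((groupVN Γ K).toStarSubalgebra.smul_mem hstar _))).congr_fun fun g => ?_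
  rw [map_sub, map_smul, hE.groupCoeff_map hτ hα, groupCoeff_piHom_mul_mul_piHom hτ hα a b hstar,
    smul_eq_mul, ← sub_mul, norm_mul, mul_pow, mul_comm]

theorem tendsto_defect_piHom (hE : IsCondExp (crossedTrace α τ) (groupVN Γ K) E)
    (hτ : IsTrace B τ) (hα : ∀ g b, τ (α g b) = τ b) (hmix : StronglyMixingAction α τ)
    {G : Subgroup (unitary (CrossedProduct α))}
    (hG : ∀ u ∈ G, ((u : CrossedProduct α) : L2 Γ K →L[ℂ] L2 Γ K) ∈ groupVN Γ K)
    (hao : AlmostOrthonormal (crossedTrace α τ) (G : Set (unitary (CrossedProduct α))))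
    (a b : B.toStarSubalgebra) :
    Tendsto (fun u : G => norm₂ (crossedTrace α τ)
      (defect hE (crossedTrace_isTrace hτ hα) u (piHom α a) (piHom α b))) cofinite (𝓝 0) := by
  have hweight (g : Γ) : Tendsto (fun u : G =>
      ‖groupCoeff τ g (star ((u : unitary (CrossedProduct α)) : CrossedProduct α))‖ ^ 2)
      cofinite (𝓝 0) := by
    simp only [norm_groupCoeff_star hτ]
    simpa using (hao.tendsto (lamHom α g)).norm.pow 2
  have hcorrelation : Tendsto (fun g => ‖τ (α g⁻¹ a * b) - τ a * τ b‖ ^ 2) cofinite (𝓝 0) := by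
    simpa using (((stronglyMixingAction_iff.1 hmix a b).comp
      inv_injective.tendsto_cofinite).norm.pow 2)
  have hsq := tendsto_weighted_sum_zero (fun _ _ => sq_nonneg _)
    (fun u : G => hasSum_norm_sq_groupCoeff_star hτ hα (hG u u.2)) hweight
    (fun _ => sq_nonneg _) hcorrelation fun u => hasSum_defect_piHom hE hτ hα (hG u u.2) a b
  simpa only [Real.sqrt_sq (norm₂_nonneg _), Real.sqrt_zero] using hsq.sqrt

end Group

variable [CommGroup Γ] {α : Γ →* (B.toStarSubalgebra ≃⋆ₐ[ℂ] B.toStarSubalgebra)}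
  {τ : B.toStarSubalgebra →ₗ[ℂ] ℂ} {E : CrossedProduct α → CrossedProduct α}

theorem commute_lamHom {v : CrossedProduct α}
    (hv : (v : L2 Γ K →L[ℂ] L2 Γ K) ∈ groupVN Γ K) (g : Γ) : Commute (lamHom α g) v := by
  have hlam (h k : Γ) : Commute (lam K h) (lam K k) :=
    congrArg Subtype.val ((Commute.all h k).map (lamHom α)).eq
  refine Subtype.ext (mem_generatedBy_iff.1 hv (lam K g) ?_).eq
  rintro _ ⟨k, rfl⟩
  rw [star_lam]
  exact ⟨hlam k g, hlam k⁻¹ g⟩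

theorem stronglyMixingRel_of_stronglyMixingAction (hτ : IsTrace B τ)
    (hα : ∀ g b, τ (α g b) = τ b) (hmix : StronglyMixingAction α τ)
    (hE : IsCondExp (crossedTrace α τ) (groupVN Γ K) E)
    {G : Subgroup (unitary (CrossedProduct α))}
    (hG : ∀ u ∈ G, ((u : CrossedProduct α) : L2 Γ K →L[ℂ] L2 Γ K) ∈ groupVN Γ K)
    (hao : AlmostOrthonormal (crossedTrace α τ) (G : Set (unitary (CrossedProduct α)))) :
    StronglyMixingRel (crossedTrace α τ) E G := by
  have hT := crossedTrace_isTrace hτ hα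
  have happrox (x : CrossedProduct α) (ε : ℝ) (hε : ε > 0) :=
    hT.normal.exists_norm₂_sub_lt (fun _ => star_mem_monomials) (mem_generatedBy_monomials x) hε
  intro x y
  refine tendsto_defect_of_span_left hE hT ?_ (happrox x)
  rintro _ ⟨⟨g, a⟩, rfl⟩
  refine tendsto_defect_of_span_right hE hT ?_ (happrox y)
  rintro _ ⟨⟨h, b⟩, rfl⟩
  refine (tendsto_defect_piHom hE hτ hα hmix hG hao a (α h b)).congr fun u => ?_
  change _ = norm₂ _ (defect hE hT u (lamHom α g * piHom α a) (lamHom α h * piHom α b))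
  rw [defect_mul_left hE hT (lamHom_mem_groupVN g) (commute_lamHom (hG u u.2) g),
    lamHom_mul_piHom, defect_mul_right hE hT (lamHom_mem_groupVN h),
    norm₂_mul_of_star_mul_self, hT.norm₂_mul_of_mul_star_self]
  · rw [star_lamHom, lamHom_mul_lamHom_inv]
  · rw [star_lamHom, lamHom_inv_mul_lamHom]

end SufficiencyOfMixing

end

end CrossedMixing

theorem proposition3p6
    {K : Type*} [NormedAddCommGroup K] [InnerProductSpace ℂ K] [CompleteSpace K]
    (B : VonNeumannAlgebra K) (τ : B.toStarSubalgebra →ₗ[ℂ] ℂ)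
    (hτ : CrossedMixing.IsTrace B τ)
    {Γ : Type*} [CommGroup Γ]
    (α : Γ →* (B.toStarSubalgebra ≃⋆ₐ[ℂ] B.toStarSubalgebra))
    (hα : ∀ (g : Γ) (b : B.toStarSubalgebra), τ (α g b) = τ b) :
    CrossedMixing.StronglyMixingIn (CrossedMixing.crossedTrace α τ) (CrossedMixing.groupVN Γ K) ↔
      CrossedMixing.StronglyMixingAction α τ :=
  ⟨CrossedMixing.stronglyMixingAction_of_stronglyMixingIn hτ hα, fun h =>
    ⟨CrossedMixing.condExp hτ hα, CrossedMixing.isCondExp_condExp hτ hα, fun _ hG hao =>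
      CrossedMixing.stronglyMixingRel_of_stronglyMixingAction hτ hα h
        (CrossedMixing.isCondExp_condExp hτ hα) hG hao⟩⟩
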